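/- Let $p>2$ be a prime and $X=\mathbb F_p=\{0,1,\dots,p-1\}$; let $\sigma$ be the permutation $x\mapsto x+1$ of $X$, and also the automorphism of the rooted tree $X^*$ of words that applies it to the first letter. For an automorphism $g$ of $X^*$ let $g|_v$ be its restriction (section) at the word $v$, and write $g=(g|_0,\dots,g|_{p-1})\pi_g$, where $\pi_g$ is the action on one-letter words. Let $\lambda=\{(\alpha_i,\beta_i):1\le i\le p^2\}$ be an enumeration of $\mathbb F_p\times\mathbb F_p$, with indices extended periodically modulo $p^2$. Put $u_i=0$, $v_i=1$ if $\beta_i=0$, and $u_i=1$, $v_i=-\alpha_i/\beta_i$ if $\beta_i\ne 0$. Define automorphisms of $X^*$ recursively by $q_i=(q_{i+1},\sigma^{u_i},1,\dots,1)$ and $r_i=(r_{i+1},\sigma^{v_i},1,\dots,1)$. Let $A=(1,\sigma,\sigma^2,\dots,\sigma^{p-1})\sigma$, and let $B_\lambda$ act trivially on words of length two, with $B_\lambda|_{00}=q_1$, $B_\lambda|_{10}=r_1$, $B_\lambda|_{21}=\sigma$ and trivial restrictions at all other words of length two. The Sushchansky group of type $\lambda$ is $G_\lambda=\langle A,B_\lambda\rangle$;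 put also $H=\langle q_1,r_1,\sigma\rangle$. For a finite generating set $S$ of a group $G$ and real $x\ge 0$, let $\gamma_G(x)$ be the number of elements of $G$ that are products of at most $x$ factors from $S\cup S^{-1}$. Write $f\preceq g$ if there is $C>0$ with $f(n)\le g(Cn)$ for all $n\in\mathbb N$, and $f\sim g$ if there is $C>0$ with $f(n/C)\le g(n)\le f(Cn)$ for all $n\in\mathbb N$. A finitely generated group has intermediate growth if $\gamma_G(n)$ grows faster than every polynomial and slower than $c^n$ for every $c>1$. A group of automorphisms of $X^*$ is called a $\mathsf G$ group if it is generated by the rooted automorphisms $(1,\dots,1)\rho$, $\rho\in R$, for a subgroup $R\le \mathrm{Sym}(X)$, together with automorphisms $\hat d$, $d\in D$, where $D$ is a group with homomorphisms $w_i:D\to \mathrm{Sym}(X)$ $(i\ge1)$, and $\hat d$ acts by $w_i(d)$ on the letter following the prefix $0^{i-1}1$ for each $i\ge 1$ and trivially on the letter following any other prefix, such that (i) $R$ and all $w_i(D)$ are transitive on $X$; (ii) for every $d\in D$, $w_i(d)$ is trivial for infinitely many $i$; (iii) for every $d\ne1$, $w_i(d)$ is nontrivial for infinitely many $i$. **Theorem.**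 For every prime $p>2$ and every $\lambda$: 1. $G_\lambda$ has intermediate growth. 2. For every finite generating set of $G_\lambda$, the growth function satisfies $$e^{n^{\alpha}}\preceq\gamma_{G_\lambda}(n)\preceq e^{n^{\beta}},\qquad \alpha=\frac{\log p}{\log p+\log 2},\quad \beta=\frac{\log p}{\log p-\log\eta_r},$$ where $r=p^2$ and $\eta_r$ is the unique positive root of $x^r+x^{r-1}+x^{r-2}-2$. 3. $H$ is a $\mathsf G$ group, and $\gamma_{G_\lambda}\sim\gamma_H$ for all choices of finite generating sets of $G_\lambda$ and $H$. -/

import Mathlib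

/-! ### Automorphisms of the rooted tree of words

The words over an alphabet `X` (lists, first letter at the head) are the vertices of a rooted
tree.  An automorphism of this tree is the same thing as a *portrait*: a permutation of `X` at every
vertex, the permutation at `v` describing how the letter following the prefix `v` is changed. -/

/-- The action on words of the tree automorphism with portrait `π`:
`x₁ x₂ x₃ … ↦ π(∅)(x₁) π(x₁)(x₂) π(x₁x₂)(x₃) …`. -/
def portraitAct {X : Type} : (List X → Equiv.Perm X) → List X → List X
  | _, [] => []
  | π, x :: w => π [] x :: portraitAct (fun v => π (x :: v)) w

/-- The inverse of `portraitAct π`. -/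
def portraitActInv {X : Type} : (List X → Equiv.Perm X) → List X → List X
  | _, [] => []
  | π, y :: w =>
      (π []).symm y :: portraitActInv (fun v => π ((π []).symm y :: v)) w

theorem portraitActInv_act {X : Type} (π : List X → Equiv.Perm X) (w : List X) :
    portraitActInv π (portraitAct π w) = w := by
  induction w generalizing π with
  | nil => rfl
  | cons x w ih => simp [portraitAct, portraitActInv, ih]

theorem portraitAct_actInv {X : Type} (π : List X → Equiv.Perm X) (w : List X) :
    portraitAct π (portraitActInv π w) = w := by
  induction w generalizing π with
  | nil => rfl
  | cons x w ih => simp [portraitAct, portraitActInv, ih]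

/-- The tree automorphism with portrait `π`, as a permutation of the set of words. -/
def treeAut {X : Type} (π : List X → Equiv.Perm X) : Equiv.Perm (List X) where
  toFun := portraitAct π
  invFun := portraitActInv π
  left_inv := portraitActInv_act π
  right_inv := portraitAct_actInv π

/-- The portrait carrying the permutation `ρ` at the root and trivial permutations elsewhere,
i.e. `(1, 1, …, 1)ρ`. -/
def rootedPortrait {X : Type} (ρ : Equiv.Perm X) : List X → Equiv.Perm X
  | [] => ρ
  | _ :: _ => 1

/-- The portraits of the automorphisms `sᵢ` of the tree over `𝔽_p` given by the recursion
`sᵢ = (sᵢ₊₁, cᵢ, 1, …, 1)`, where `cᵢ` is regarded as a rooted automorphism; that is, `sᵢ` carries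
`cᵢ₊ₖ` at the vertex `0ᵏ1` for all `k ≥ 0`, and trivial permutations elsewhere. -/
def spinalPortrait {p : ℕ} (c : ℕ → Equiv.Perm (ZMod p)) :
    ℕ → List (ZMod p) → Equiv.Perm (ZMod p)
  | _, [] => 1
  | i, x :: w =>
      if x = 0 then spinalPortrait c (i + 1) w
      else if x = 1 then rootedPortrait (c i) w
      else 1

/-- The permutation `σᵃ : x ↦ x + a` of `𝔽_p`, where `σ = (0, 1, …, p - 1)`. -/
def sigmaPow {p : ℕ} (a : ZMod p) : Equiv.Perm (ZMod p) := Equiv.addRight a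

/-- The rooted automorphism `σ = (1, …, 1)σ`. -/
def sigmaAut (p : ℕ) : Equiv.Perm (List (ZMod p)) :=
  treeAut (rootedPortrait (sigmaPow 1))

/-! ### Sushchansky groups

An order `λ = {(αᵢ, βᵢ), i = 1, …, p²}` on `𝔽_p × 𝔽_p`, extended periodically to all indices, is a
bijection `lam` from the residues modulo `p²` to `𝔽_p × 𝔽_p`: `(αᵢ, βᵢ) = lam i`. -/

/-- `uᵢ = 0` if `βᵢ = 0` and `uᵢ = 1` otherwise. -/
def wordU {p : ℕ} (lam : ZMod (p ^ 2) ≃ ZMod p × ZMod p) (i : ℕ) : ZMod p :=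
  if (lam i).2 = 0 then 0 else 1

/-- `vᵢ = 1` if `βᵢ = 0` and `vᵢ = -αᵢ / βᵢ` otherwise. -/
def wordV {p : ℕ} [Fact p.Prime] (lam : ZMod (p ^ 2) ≃ ZMod p × ZMod p) (i : ℕ) : ZMod p :=
  if (lam i).2 = 0 then 1 else -((lam i).1 / (lam i).2)

/-- The portrait of `qᵢ = (qᵢ₊₁, σ^{uᵢ}, 1, …, 1)`. -/
def qPortrait {p : ℕ} (lam : ZMod (p ^ 2) ≃ ZMod p × ZMod p) (i : ℕ) :
    List (ZMod p) → Equiv.Perm (ZMod p) :=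
  spinalPortrait (fun j => sigmaPow (wordU lam j)) i

/-- The portrait of `rᵢ = (rᵢ₊₁, σ^{vᵢ}, 1, …, 1)`. -/
def rPortrait {p : ℕ} [Fact p.Prime] (lam : ZMod (p ^ 2) ≃ ZMod p × ZMod p) (i : ℕ) :
    List (ZMod p) → Equiv.Perm (ZMod p) :=
  spinalPortrait (fun j => sigmaPow (wordV lam j)) i

/-- The portrait of the tableau `A = [1, x₁, 0, 0, …]`, i.e. of `A = (1, σ, σ², …, σᵖ⁻¹)σ`. -/
def portraitA (p : ℕ) : List (ZMod p) → Equiv.Perm (ZMod p)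
  | [] => sigmaPow 1
  | [x] => sigmaPow x
  | _ :: _ :: _ => 1

/-- The portrait of `B_λ`: the action on words of length two is trivial, the restrictions are
`B_λ|₀₀ = q₁`, `B_λ|₁₀ = r₁`, `B_λ|₂₁ = σ`, and the restrictions to the other words of length two
are trivial. -/
def portraitB {p : ℕ} [Fact p.Prime] (lam : ZMod (p ^ 2) ≃ ZMod p × ZMod p) :
    List (ZMod p) → Equiv.Perm (ZMod p)
  | [] => 1
  | [_] => 1
  | x :: y :: w =>
      if x = 0 ∧ y = 0 then qPortrait lam 1 w
      else if x = 1 ∧ y = 0 then rPortrait lam 1 w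
      else if x = 2 ∧ y = 1 then rootedPortrait (sigmaPow 1) w
      else 1

/-- The Sushchansky group `G_λ = ⟨A, B_λ⟩`. -/
def sushchanskyGroup {p : ℕ} [Fact p.Prime] (lam : ZMod (p ^ 2) ≃ ZMod p × ZMod p) :
    Subgroup (Equiv.Perm (List (ZMod p))) :=
  Subgroup.closure {treeAut (portraitA p), treeAut (portraitB lam)}

/-- The group `H = ⟨q₁, r₁, σ⟩`. -/
def groupH {p : ℕ} [Fact p.Prime] (lam : ZMod (p ^ 2) ≃ ZMod p × ZMod p) :
    Subgroup (Equiv.Perm (List (ZMod p))) :=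
  Subgroup.closure {treeAut (qPortrait lam 1), treeAut (rPortrait lam 1), sigmaAut p}

/-- `G` is a `𝖦` group acting on words over `X = 𝔽_p`: it is generated by the rooted automorphisms
of a root part `R ≤ Sym(X)` together with the automorphisms `d̂`, `d ∈ D`, where `D` is a group with
homomorphisms `wᵢ : D → Sym(X)`, `i ≥ 1`, and `d̂` carries `wᵢ(d)` at the vertex `0ⁱ⁻¹1` for
`i ≥ 1` and trivial permutations elsewhere, subject to
(i) `R` and all `wᵢ(D)` are transitive on `X`;
(ii) every `wᵢ(d)` is trivial for infinitely many `i`;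
(iii) if `d ≠ 1`, then `wᵢ(d)` is nontrivial for infinitely many `i`. -/
def IsGGroup {p : ℕ} (G : Subgroup (Equiv.Perm (List (ZMod p)))) : Prop :=
  ∃ (R : Subgroup (Equiv.Perm (ZMod p))) (D : Type) (_ : Group D)
    (w : ℕ → D →* Equiv.Perm (ZMod p)),
    G = Subgroup.closure
      ({g | ∃ ρ ∈ R, g = treeAut (rootedPortrait ρ)} ∪
        {g | ∃ d : D, g = treeAut (spinalPortrait (fun i => w i d) 1)}) ∧
    (∀ x y, ∃ ρ ∈ R, ρ x = y) ∧
    (∀ i, 1 ≤ i → ∀ x y, ∃ d, w i d x = y) ∧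
    (∀ d, {i | w i d = 1}.Infinite) ∧
    (∀ d, d ≠ 1 → {i | w i d ≠ 1}.Infinite)

/-! ### Growth -/

/-- The growth function of a group with respect to `S`: the number of elements that are products of
at most `x` factors from `S ∪ S⁻¹` (`x` real, so that `γ(n / C)` makes sense). -/
noncomputable def growthFunction {G : Type} [Group G] (S : Set G) (x : ℝ) : ℝ :=
  (Set.ncard {g : G | ∃ l : List G, (∀ s ∈ l, s ∈ S ∨ s⁻¹ ∈ S) ∧ (l.length : ℝ) ≤ x ∧
    l.prod = g} : ℝ)

/-- `S` is a finite generating set of the group. -/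
def IsFiniteGeneratingSet {G : Type} [Group G] (S : Set G) : Prop :=
  S.Finite ∧ Subgroup.closure S = ⊤

/-- `f ⪯ g`: there is `C > 0` with `f(n) ≤ g(Cn)` for all `n`. -/
def GrowthLE (f g : ℝ → ℝ) : Prop :=
  ∃ C : ℝ, 0 < C ∧ ∀ n : ℕ, f n ≤ g (C * n)

/-- `f ∼ g`: there is `C > 0` with `f(n / C) ≤ g(n) ≤ f(Cn)` for all `n`. -/
def GrowthEquiv (f g : ℝ → ℝ) : Prop :=
  ∃ C : ℝ, 0 < C ∧ ∀ n : ℕ, f (n / C) ≤ g n ∧ g n ≤ f (C * n)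

/-- A finitely generated group has intermediate growth if its growth function grows faster than
every polynomial and slower than every exponential function. -/
def HasIntermediateGrowth (G : Type) [Group G] : Prop :=
  Group.FG G ∧ ∀ S : Set G, IsFiniteGeneratingSet S →
    (∀ d : ℕ, Asymptotics.IsLittleO Filter.atTop (fun n : ℕ => (n : ℝ) ^ d)
      (fun n : ℕ => growthFunction S n)) ∧
    (∀ c : ℝ, 1 < c → Asymptotics.IsLittleO Filter.atTop (fun n : ℕ => growthFunction S n)
      (fun n : ℕ => c ^ n))

/-! Everything is read off from word balls of `H`. With `D = 𝔽_p × 𝔽_p`, the pair `(a, b)` gives a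
spinal automorphism whose rotation at `0ᵏ1` is a linear form `coeff lam (i + k)` evaluated at `(a,
b)`. An element of `H` is then a word in spinal syllables and rotations, and it can be made
alternating. The starting index `i` varies because sections of syllables of index `i` are syllables
of index `i + 1`; estimates are therefore proved for all `i` at once.

Lower bound. An element with `k` spinal syllables at index `i + 1` occurs as a section of an element
with at most `2k + 1` of them at index `i`, whose other sections take boundedly many values
(`exists_lift`). Multiplying `p` rotated copies realizes `p`-tuples, up to a bounded ambiguity: a
ball of radius `k` raised to the power `p` is at most a constant times a ball of radius `p(2k + 1)`
(`ncard_spinBall_pow_le`). Raising the cardinality to the power `p` thus costs a factor of about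
`2p` in the radius, whence the exponent `log p / log (2p)`.

Upper bound. Every syllable gets a weight such that the total weight of the sections of an
alternating word is at most `y` times its own weight (`spinWeight_contract`, `exists_sections`).
This weight is subadditive when `2 ≤ y^R + y^(R-1) + y^(R-2)`, where each `d` is killed by some form
in every window of `R` indices. Counting tuples of sections and using concavity of `x^β` gives `exp
(C n^β)` (`ncard_contractingBall_le_exp`). For `p > 2` the window can be taken of length `r - 1`
instead of `r`, because `d` and `2d` are killed by the same forms (`exists_coeff_eq_zero`). This
permits some `y < η_r`, and the gap absorbs all lower order terms, so the exponent attached to `η_r`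
itself is reached.

Comparison. Second level sections of a word in `A`, `B_λ` are words of no greater length in the
generators of `H`, so balls of `G_λ` are at most a constant times the power `p²` of balls of `H`.
Such powers are again bounded by balls of `H` of linearly larger radius: iterate the lower bound
inequality `p²` times, after which periodicity restores the index. Conversely each element of `H` is
a section of an element of `G_λ` of comparable length (`exists_section_eq`). -/

/-! ### Wreath recursion -/

/-- The permutation `(f x)_x π` of the set of words: `x w ↦ π(x) (f x)(w)`. -/
def wreath {X : Type} (f : X → Equiv.Perm (List X)) (π : Equiv.Perm X) :
    Equiv.Perm (List X) where
  toFun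
    | [] => []
    | x :: w => π x :: f x w
  invFun
    | [] => []
    | y :: w => π.symm y :: (f (π.symm y)).symm w
  left_inv w := by cases w <;> simp
  right_inv w := by cases w <;> simp

@[simp] theorem wreath_nil {X : Type} (f : X → Equiv.Perm (List X)) (π : Equiv.Perm X) :
    wreath f π [] = [] := rfl

@[simp] theorem wreath_cons {X : Type} (f : X → Equiv.Perm (List X)) (π : Equiv.Perm X)
    (x : X) (w : List X) : wreath f π (x :: w) = π x :: f x w := rfl

theorem wreath_mul {X : Type} (f g : X → Equiv.Perm (List X)) (π ρ : Equiv.Perm X) :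
    wreath f π * wreath g ρ = wreath (fun x => f (ρ x) * g x) (π * ρ) := by
  ext1 w; cases w <;> simp

theorem wreath_one {X : Type} : wreath (fun _ : X => (1 : Equiv.Perm (List X))) 1 = 1 := by
  ext1 w; cases w <;> simp

theorem wreath_inv {X : Type} (f : X → Equiv.Perm (List X)) (π : Equiv.Perm X) :
    (wreath f π)⁻¹ = wreath (fun x => (f (π⁻¹ x))⁻¹) π⁻¹ := by
  rw [inv_eq_iff_mul_eq_one, wreath_mul, ← wreath_one]
  simp

theorem wreath_inj {X : Type} [Inhabited X] {f g : X → Equiv.Perm (List X)} {π ρ : Equiv.Perm X}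
    (h : wreath f π = wreath g ρ) : f = g ∧ π = ρ := by
  have key : ∀ x w, π x = ρ x ∧ f x w = g x w := fun x w => by
    simpa using congrArg (fun e : Equiv.Perm (List X) => e (x :: w)) h
  exact ⟨funext fun x => Equiv.ext fun w => (key x w).2, Equiv.ext fun x => (key x []).1⟩

theorem treeAut_eq_wreath {X : Type} (P : List X → Equiv.Perm X) :
    treeAut P = wreath (fun x => treeAut (fun v => P (x :: v))) (P []) := by
  ext1 w; cases w <;> rfl

theorem treeAut_one {X : Type} : treeAut (fun _ : List X => (1 : Equiv.Perm X)) = 1 := by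
  ext1 w
  induction w with
  | nil => rfl
  | cons x w ih => rw [treeAut_eq_wreath, wreath_cons, ih]; rfl

/-! ### Rooted and spinal automorphisms over `𝔽_p` -/

theorem sigmaPow_apply {p : ℕ} (a x : ZMod p) : sigmaPow a x = x + a := rfl

theorem sigmaPow_zero {p : ℕ} : sigmaPow (0 : ZMod p) = 1 := by
  ext1 x; simp [sigmaPow_apply]

theorem sigmaPow_add {p : ℕ} (a b : ZMod p) : sigmaPow (a + b) = sigmaPow a * sigmaPow b := by
  ext1 x; simp [sigmaPow_apply]; ring

theorem sigmaPow_injective {p : ℕ} : Function.Injective (sigmaPow (p := p)) := fun a b h => by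
  simpa [sigmaPow_apply] using congrArg (fun e : Equiv.Perm (ZMod p) => e 0) h

/-- The rooted automorphism `σᵃ`. -/
def rot {p : ℕ} (a : ZMod p) : Equiv.Perm (List (ZMod p)) :=
  treeAut (rootedPortrait (sigmaPow a))

theorem treeAut_rooted {X : Type} (ρ : Equiv.Perm X) :
    treeAut (rootedPortrait ρ) = wreath (fun _ => 1) ρ := by
  rw [treeAut_eq_wreath]
  congr 1
  funext x
  exact treeAut_one

theorem rot_eq {p : ℕ} (a : ZMod p) : rot a = wreath (fun _ => 1) (sigmaPow a) :=
  treeAut_rooted _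

theorem rot_zero {p : ℕ} : rot (0 : ZMod p) = 1 := by
  rw [rot_eq, sigmaPow_zero, wreath_one]

theorem rot_add {p : ℕ} (a b : ZMod p) : rot (a + b) = rot a * rot b := by
  simp [rot_eq, wreath_mul, sigmaPow_add]

theorem rot_neg {p : ℕ} (a : ZMod p) : rot (-a) = (rot a)⁻¹ := by
  rw [eq_inv_iff_mul_eq_one, ← rot_add, neg_add_cancel, rot_zero]

/-- The spinal automorphism attached to `d` by a sequence of homomorphisms `c`, starting with
the index `i`. -/
def spin {p : ℕ} {D : Type} [AddCommGroup D] (c : ℕ → D →+ ZMod p) (i : ℕ) (d : D) :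
    Equiv.Perm (List (ZMod p)) :=
  treeAut (spinalPortrait (fun j => sigmaPow (c j d)) i)

theorem treeAut_spinal {p : ℕ} (s : ℕ → Equiv.Perm (ZMod p)) (i : ℕ) :
    treeAut (spinalPortrait s i) = wreath (fun x => if x = 0 then treeAut (spinalPortrait s (i + 1))
      else if x = 1 then treeAut (rootedPortrait (s i)) else 1) 1 := by
  rw [treeAut_eq_wreath]
  congr 1
  funext x
  by_cases h0 : x = 0
  · simp [spinalPortrait, h0]
  · by_cases h1 : x = 1
    · subst h1
      simp [spinalPortrait, h0]
    · simp only [spinalPortrait, h0, h1, if_false]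
      exact treeAut_one

theorem spin_eq {p : ℕ} {D : Type} [AddCommGroup D] (c : ℕ → D →+ ZMod p) (i : ℕ) (d : D) :
    spin c i d = wreath (fun x => if x = 0 then spin c (i + 1) d
      else if x = 1 then rot (c i d) else 1) 1 :=
  treeAut_spinal _ _

theorem spin_add {p : ℕ} {D : Type} [AddCommGroup D] (c : ℕ → D →+ ZMod p) (i : ℕ) (d e : D) :
    spin c i (d + e) = spin c i d * spin c i e := by
  ext1 w
  induction w generalizing i with
  | nil => rfl
  | cons x w ih =>
    rw [Equiv.Perm.mul_apply, spin_eq c i, spin_eq c i, spin_eq c i]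
    simp only [wreath_cons, Equiv.Perm.one_apply]
    by_cases h0 : x = 0
    · simpa [h0] using ih (i + 1)
    · by_cases h1 : x = 1
      · subst h1
        simp [h0, rot_add]
      · simp [h0, h1]

theorem spin_zero {p : ℕ} {D : Type} [AddCommGroup D] (c : ℕ → D →+ ZMod p) (i : ℕ) :
    spin c i 0 = 1 := by
  have h := spin_add c i 0 0
  rw [add_zero] at h
  exact left_eq_mul.mp h

theorem spin_neg {p : ℕ} {D : Type} [AddCommGroup D] (c : ℕ → D →+ ZMod p) (i : ℕ) (d : D) :
    spin c i (-d) = (spin c i d)⁻¹ := by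
  rw [eq_inv_iff_mul_eq_one, ← spin_add, neg_add_cancel, spin_zero]

/-! ### Words in syllables, weighted balls and alternating forms -/

/-- A syllable: an element of `D` stands for the corresponding spinal automorphism, an element of
`𝔽_p` for a rooted one. -/
def syllable {p : ℕ} {D : Type} [AddCommGroup D] (c : ℕ → D →+ ZMod p) (i : ℕ) :
    D ⊕ ZMod p → Equiv.Perm (List (ZMod p)) :=
  Sum.elim (spin c i) rot

theorem syllable_inl {p : ℕ} {D : Type} [AddCommGroup D] (c : ℕ → D →+ ZMod p) (i : ℕ) (d : D) :
    syllable c i (Sum.inl d) = spin c i d := rfl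

theorem syllable_inr {p : ℕ} {D : Type} [AddCommGroup D] (c : ℕ → D →+ ZMod p) (i : ℕ)
    (a : ZMod p) : syllable c i (Sum.inr a) = rot a := rfl

/-- The elements that can be written with syllables of total weight at most `t`. -/
def weightBall {p : ℕ} {D : Type} [AddCommGroup D] (c : ℕ → D →+ ZMod p) (i : ℕ)
    (τ : D ⊕ ZMod p → ℝ) (t : ℝ) : Set (Equiv.Perm (List (ZMod p))) :=
  {g | ∃ L : List (D ⊕ ZMod p), (L.map τ).sum ≤ t ∧ (L.map (syllable c i)).prod = g}

/-- The alternating product `∏ d_j r_j`. -/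
def altProd {p : ℕ} {D : Type} [AddCommGroup D] (c : ℕ → D →+ ZMod p) (i : ℕ)
    (M : List (D × ZMod p)) : Equiv.Perm (List (ZMod p)) :=
  (M.map fun m => spin c i m.1 * rot m.2).prod

theorem altProd_cons {p : ℕ} {D : Type} [AddCommGroup D] (c : ℕ → D →+ ZMod p) (i : ℕ)
    (m : D × ZMod p) (M : List (D × ZMod p)) :
    altProd c i (m :: M) = spin c i m.1 * rot m.2 * altProd c i M := by
  simp [altProd]

/-- Alternating normal form: adjacent syllables of the same kind can be merged without increasing
the weight. -/
theorem exists_altProd {p : ℕ} {D : Type} [AddCommGroup D] (c : ℕ → D →+ ZMod p) (i : ℕ)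
    {τ₀ : ℝ} (h₀ : 0 ≤ τ₀) {τ : D → ℝ} (hτ : ∀ d, 0 ≤ τ d)
    (htri : ∀ d e, τ (d + e) ≤ τ d + τ e) (L : List (D ⊕ ZMod p)) :
    ∃ (a : ZMod p) (M : List (D × ZMod p)),
      (L.map (syllable c i)).prod = rot a * altProd c i M ∧
      (M.map fun m => τ₀ + τ m.1).sum ≤ (L.map (Sum.elim τ fun _ => τ₀)).sum + τ₀ := by
  -- The induction needs the stronger claim that the leading rotation is paid for as well, so that
  -- it can later be paired with a spinal syllable placed before it.
  suffices H : ∃ (a : ZMod p) (M : List (D × ZMod p)),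
      (L.map (syllable c i)).prod = rot a * altProd c i M ∧
      (if a = 0 then 0 else τ₀) + (M.map fun m => τ₀ + τ m.1).sum ≤
        (L.map (Sum.elim τ fun _ => τ₀)).sum + τ₀ by
    obtain ⟨a, M, h1, h2⟩ := H
    refine ⟨a, M, h1, le_trans ?_ h2⟩
    split_ifs <;> linarith
  induction L with
  | nil => exact ⟨0, [], by simp [rot_zero, altProd], by simpa using h₀⟩
  | cons s L ih =>
    obtain ⟨a, M, h1, h2⟩ := ih
    have hL : 0 ≤ (L.map (Sum.elim τ fun _ => τ₀)).sum := by
      apply List.sum_nonneg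
      intro x hx
      obtain ⟨y, -, rfl⟩ := List.mem_map.mp hx
      rcases y with y | y
      · exact hτ y
      · exact h₀
    rcases s with d | b
    · by_cases ha : a = 0
      · subst ha
        rcases M with _ | ⟨m, M⟩
        -- Only here is a pair with trivial rotation created, at the end of the word; the extra `τ₀`
        -- on the right pays for it.
        · refine ⟨0, [(d, 0)], ?_, ?_⟩
          · simp [h1, altProd, syllable_inl, rot_zero]
          · simp only [List.map_cons, List.sum_cons, List.map_nil, List.sum_nil, Sum.elim_inl,
              if_true]
            linarith
        · refine ⟨0, (d + m.1, m.2) :: M, ?_, ?_⟩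
          · simp [h1, altProd_cons, syllable_inl, rot_zero, spin_add, mul_assoc]
          · have := htri d m.1
            simp only [List.map_cons, List.sum_cons, Sum.elim_inl, if_true] at h2 ⊢
            linarith
      · refine ⟨0, (d, a) :: M, ?_, ?_⟩
        · simp [h1, altProd_cons, syllable_inl, rot_zero, mul_assoc]
        · simp only [List.map_cons, List.sum_cons, Sum.elim_inl, if_true, ha, if_false] at h2 ⊢
          linarith
    · refine ⟨b + a, M, ?_, ?_⟩
      · simp [h1, syllable_inr, rot_add, mul_assoc]
      · simp only [List.map_cons, List.sum_cons, Sum.elim_inr]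
        have : (if b + a = 0 then (0 : ℝ) else τ₀) ≤ τ₀ := by split_ifs <;> linarith
        have : (0 : ℝ) ≤ (if a = 0 then (0 : ℝ) else τ₀) := by split_ifs <;> linarith
        linarith

theorem weightBall_mul {p : ℕ} {D : Type} [AddCommGroup D] (c : ℕ → D →+ ZMod p) (i : ℕ)
    {τ : D ⊕ ZMod p → ℝ} {s t : ℝ} {g h : Equiv.Perm (List (ZMod p))}
    (hg : g ∈ weightBall c i τ s) (hh : h ∈ weightBall c i τ t) :
    g * h ∈ weightBall c i τ (s + t) := by
  obtain ⟨L, h1, rfl⟩ := hg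
  obtain ⟨L', h2, rfl⟩ := hh
  exact ⟨L ++ L', by simpa using add_le_add h1 h2, by simp⟩

theorem weightBall_mono {p : ℕ} {D : Type} [AddCommGroup D] (c : ℕ → D →+ ZMod p) (i : ℕ)
    (τ : D ⊕ ZMod p → ℝ) {s t : ℝ} (h : s ≤ t) : weightBall c i τ s ⊆ weightBall c i τ t :=
  fun _ ⟨L, h1, h2⟩ => ⟨L, h1.trans h, h2⟩

theorem one_mem_weightBall {p : ℕ} {D : Type} [AddCommGroup D] (c : ℕ → D →+ ZMod p) (i : ℕ)
    (τ : D ⊕ ZMod p → ℝ) {t : ℝ} (h : 0 ≤ t) : 1 ∈ weightBall c i τ t :=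
  ⟨[], by simpa using h, rfl⟩

theorem syllable_mem_weightBall {p : ℕ} {D : Type} [AddCommGroup D] (c : ℕ → D →+ ZMod p) (i : ℕ)
    {τ : D ⊕ ZMod p → ℝ} {t : ℝ} (s : D ⊕ ZMod p) (h : τ s ≤ t) :
    syllable c i s ∈ weightBall c i τ t :=
  ⟨[s], by simpa using h, by simp⟩

/-- Balls with respect to a subadditive weight bounded below by `ε` are finite, with a bound on the
cardinality that does not depend on the sequence of homomorphisms. -/
theorem weightBall_subset_image {p : ℕ} {D : Type} [AddCommGroup D]
    (c : ℕ → D →+ ZMod p) (i : ℕ)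
    {τ₀ : ℝ} (h₀ : 0 ≤ τ₀) {ε : ℝ} (hε : 0 < ε) {τ : D → ℝ} (hτ : ∀ d, ε ≤ τ d)
    (htri : ∀ d e, τ (d + e) ≤ τ d + τ e) (t : ℝ) (K : ℕ) (hK : t + τ₀ ≤ ε * K) :
    weightBall c i (Sum.elim τ fun _ => τ₀) t ⊆
      (fun q : ZMod p × List (D × ZMod p) => rot q.1 * altProd c i q.2) ''
        (Set.univ ×ˢ {M | M.length ≤ K}) := by
  rintro g ⟨L, hL, rfl⟩
  obtain ⟨a, M, h1, h2⟩ := exists_altProd c i h₀ (fun d => hε.le.trans (hτ d)) htri L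
  refine ⟨(a, M), ⟨trivial, ?_⟩, h1.symm⟩
  have h3 : (M.length : ℝ) * ε ≤ (M.map fun m => τ₀ + τ m.1).sum := by
    have := List.card_nsmul_le_sum (M.map fun m => τ₀ + τ m.1) ε (by
      intro x hx
      obtain ⟨y, -, rfl⟩ := List.mem_map.mp hx
      linarith [hτ y.1])
    simpa using this
  have h4 : (M.length : ℝ) * ε ≤ K * ε := by linarith
  exact_mod_cast le_of_mul_le_mul_right h4 hε

theorem finite_altForms (p : ℕ) [NeZero p] (D : Type) [Finite D] (K : ℕ) :
    ((Set.univ : Set (ZMod p)) ×ˢ {M : List (D × ZMod p) | M.length ≤ K}).Finite :=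
  Set.finite_univ.prod (List.finite_length_le _ K)

theorem finite_weightBall {p : ℕ} [NeZero p] {D : Type} [AddCommGroup D] [Finite D]
    (c : ℕ → D →+ ZMod p) (i : ℕ)
    {τ₀ : ℝ} (h₀ : 0 ≤ τ₀) {ε : ℝ} (hε : 0 < ε) {τ : D → ℝ} (hτ : ∀ d, ε ≤ τ d)
    (htri : ∀ d e, τ (d + e) ≤ τ d + τ e) (t : ℝ) :
    (weightBall c i (Sum.elim τ fun _ => τ₀) t).Finite := by
  obtain ⟨K, hK⟩ := exists_nat_ge ((t + τ₀) / ε)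
  exact ((finite_altForms p D K).image _).subset (weightBall_subset_image c i h₀ hε hτ htri t K
    (by rwa [div_le_iff₀' hε] at hK))

/-! ### Word balls -/

/-- The elements of a group that are products of at most `n` factors from `S ∪ S⁻¹`. -/
def wordBall {G : Type} [Group G] (S : Set G) (n : ℕ) : Set G :=
  {g | ∃ l : List G, (∀ s ∈ l, s ∈ S ∨ s⁻¹ ∈ S) ∧ l.length ≤ n ∧ l.prod = g}

theorem wordBall_mono {G : Type} [Group G] (S : Set G) {m n : ℕ} (h : m ≤ n) :
    wordBall S m ⊆ wordBall S n :=
  fun _ ⟨l, h1, h2, h3⟩ => ⟨l, h1, h2.trans h, h3⟩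

theorem wordBall_mul {G : Type} [Group G] {S : Set G} {m n : ℕ} {g h : G}
    (hg : g ∈ wordBall S m) (hh : h ∈ wordBall S n) : g * h ∈ wordBall S (m + n) := by
  obtain ⟨l, h1, h2, rfl⟩ := hg
  obtain ⟨l', h1', h2', rfl⟩ := hh
  refine ⟨l ++ l', ?_, ?_, by simp⟩
  · intro s hs
    rcases List.mem_append.mp hs with hs | hs
    · exact h1 s hs
    · exact h1' s hs
  · rw [List.length_append]
    omega

theorem wordBall_inv {G : Type} [Group G] {S : Set G} {n : ℕ} {g : G}
    (hg : g ∈ wordBall S n) : g⁻¹ ∈ wordBall S n := by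
  obtain ⟨l, h1, h2, rfl⟩ := hg
  refine ⟨(l.map fun x => x⁻¹).reverse, ?_, by simpa using h2, ?_⟩
  · intro s hs
    simp only [List.mem_reverse, List.mem_map] at hs
    obtain ⟨t, ht, rfl⟩ := hs
    simpa [or_comm] using h1 t ht
  · rw [List.prod_inv_reverse]

theorem one_mem_wordBall {G : Type} [Group G] (S : Set G) (n : ℕ) : 1 ∈ wordBall S n :=
  ⟨[], by simp, by simp, rfl⟩

theorem mem_wordBall_one {G : Type} [Group G] {S : Set G} {g : G} (h : g ∈ S) :
    g ∈ wordBall S 1 :=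
  ⟨[g], by simpa using Or.inl h, by simp, by simp⟩

/-- Induction on the length of words. -/
theorem wordBall_induction {G : Type} [Group G] {S : Set G} {P : ℕ → G → Prop}
    (h1 : ∀ n, P n 1)
    (hmul : ∀ n s g, (s ∈ S ∨ s⁻¹ ∈ S) → P n g → P (n + 1) (s * g))
    {n : ℕ} {g : G} (hg : g ∈ wordBall S n) : P n g := by
  obtain ⟨l, hl, hn, rfl⟩ := hg
  induction l generalizing n with
  | nil => exact h1 n
  | cons s l ih =>
    obtain ⟨n, rfl⟩ : ∃ m, n = m + 1 := ⟨n - 1, by simp at hn; omega⟩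
    rw [List.prod_cons]
    refine hmul n s _ (hl s (by simp)) (ih (fun t ht => hl t (by simp [ht])) ?_)
    simpa using hn

theorem finite_wordBall {G : Type} [Group G] {S : Set G} (hS : S.Finite) (n : ℕ) :
    (wordBall S n).Finite := by
  have hT : (S ∪ S⁻¹).Finite := hS.union hS.inv
  have : Finite ↥(S ∪ S⁻¹) := hT
  refine ((List.finite_length_le ↥(S ∪ S⁻¹) n).image
    fun l => (l.map Subtype.val).prod).subset ?_
  rintro g ⟨l, h1, h2, rfl⟩
  have h1' : ∀ s ∈ l, s ∈ S ∪ S⁻¹ := h1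
  refine ⟨l.attachWith _ h1', by simpa using h2, ?_⟩
  simp

theorem exists_mem_wordBall {G : Type} [Group G] {S : Set G} {g : G}
    (hg : g ∈ Subgroup.closure S) : ∃ n, g ∈ wordBall S n := by
  induction hg using Subgroup.closure_induction with
  | mem x hx => exact ⟨1, mem_wordBall_one hx⟩
  | one => exact ⟨0, one_mem_wordBall S 0⟩
  | mul x y _ _ hx hy =>
    obtain ⟨m, hm⟩ := hx
    obtain ⟨n, hn⟩ := hy
    exact ⟨m + n, wordBall_mul hm hn⟩
  | inv x _ hx =>
    obtain ⟨m, hm⟩ := hx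
    exact ⟨m, wordBall_inv hm⟩

/-- Changing the generating set changes lengths by at most a constant factor. -/
theorem exists_wordBall_subset {G : Type} [Group G] {S T : Set G} (hT : T.Finite)
    (h : T ⊆ Subgroup.closure S) : ∃ C : ℕ, ∀ n, wordBall T n ⊆ wordBall S (C * n) := by
  obtain ⟨C, hC⟩ : ∃ C, T ⊆ wordBall S C := by
    induction T, hT using Set.Finite.induction_on with
    | empty => exact ⟨0, Set.empty_subset _⟩
    | @insert a T _ _ ih =>
      obtain ⟨C, hC⟩ := ih ((Set.subset_insert a T).trans h)
      obtain ⟨m, hm⟩ := exists_mem_wordBall (h (Set.mem_insert a T))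
      refine ⟨max m C, Set.insert_subset (wordBall_mono S (le_max_left _ _) hm)
        (hC.trans (wordBall_mono S (le_max_right _ _)))⟩
  refine ⟨C, fun n g hg => ?_⟩
  refine wordBall_induction (P := fun n g => g ∈ wordBall S (C * n))
    (fun n => one_mem_wordBall S _) (fun n s g hs hg => ?_) hg
  have hs' : s ∈ wordBall S C := by
    rcases hs with hs | hs
    · exact hC hs
    · simpa using wordBall_inv (hC hs)
  have := wordBall_mul hs' hg
  rwa [show C + C * n = C * (n + 1) by ring] at this

theorem image_val_wordBall {G : Type} [Group G] {H : Subgroup G} (S : Set H) (n : ℕ) :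
    Subtype.val '' wordBall S n = wordBall (Subtype.val '' S) n := by
  ext g
  constructor
  · rintro ⟨h, ⟨l, h1, h2, rfl⟩, rfl⟩
    refine ⟨l.map Subtype.val, ?_, by simpa using h2, ?_⟩
    · intro s hs
      obtain ⟨t, ht, rfl⟩ := List.mem_map.mp hs
      rcases h1 t ht with h | h
      · exact Or.inl ⟨t, h, rfl⟩
      · exact Or.inr ⟨t⁻¹, h, rfl⟩
    · exact (map_list_prod H.subtype l).symm
  · intro hg
    refine wordBall_induction (P := fun n g => g ∈ Subtype.val '' wordBall S n)
      (fun n => ⟨1, one_mem_wordBall S n, rfl⟩) (fun n s g hs hg => ?_) hg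
    obtain ⟨h, hh, rfl⟩ := hg
    rcases hs with ⟨t, ht, rfl⟩ | ⟨t, ht, hts⟩
    · refine ⟨t * h, ?_, rfl⟩
      rw [add_comm]
      exact wordBall_mul (mem_wordBall_one ht) hh
    · refine ⟨t⁻¹ * h, ?_, by simp [hts]⟩
      rw [add_comm]
      exact wordBall_mul (wordBall_inv (mem_wordBall_one ht)) hh

theorem closure_image_val {G : Type} [Group G] {H : Subgroup G} {S : Set H}
    (hS : Subgroup.closure S = ⊤) : Subgroup.closure (Subtype.val '' S) = H := by
  have := H.subtype.map_closure S
  rw [hS] at this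
  rw [← Subgroup.coe_subtype, ← this, ← MonoidHom.range_eq_map, Subgroup.range_subtype]

/-- The growth function counts the elements of word balls in the ambient group. -/
theorem growthFunction_eq {G : Type} [Group G] {H : Subgroup G} (S : Set H) {x : ℝ} (hx : 0 ≤ x) :
    growthFunction S x = ((wordBall (Subtype.val '' S) ⌊x⌋₊).ncard : ℝ) := by
  rw [← image_val_wordBall, Set.ncard_image_of_injective _ Subtype.val_injective]
  simp only [growthFunction, wordBall, Nat.le_floor_iff hx]

theorem ncard_wordBall_le {G : Type} [Group G] {S T : Set G} (hS : S.Finite) {m n : ℕ}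
    (h : wordBall T m ⊆ wordBall S n) : (wordBall T m).ncard ≤ (wordBall S n).ncard :=
  Set.ncard_le_ncard h (finite_wordBall hS n)

theorem ncard_wordBall_mono {G : Type} [Group G] {S : Set G} (hS : S.Finite) {m n : ℕ}
    (h : m ≤ n) : (wordBall S m).ncard ≤ (wordBall S n).ncard :=
  ncard_wordBall_le hS (wordBall_mono S h)

theorem ncard_wordBall_zero {G : Type} [Group G] (S : Set G) : (wordBall S 0).ncard = 1 := by
  rw [Set.ncard_eq_one]
  refine ⟨1, Set.Subset.antisymm ?_ (by simpa using one_mem_wordBall S 0)⟩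
  rintro g ⟨l, -, h2, rfl⟩
  simp [List.length_eq_zero_iff.mp (Nat.le_zero.mp h2)]

/-! ### Lower bounds -/

/-- The elements that can be written with at most `k` spinal syllables. -/
def spinBall {p : ℕ} {D : Type} [AddCommGroup D] (c : ℕ → D →+ ZMod p) (i k : ℕ) :
    Set (Equiv.Perm (List (ZMod p))) :=
  weightBall c i (Sum.elim (fun _ => 1) fun _ => 0) k

theorem finite_spinBall {p : ℕ} [NeZero p] {D : Type} [AddCommGroup D] [Finite D]
    (c : ℕ → D →+ ZMod p) (i k : ℕ) : (spinBall c i k).Finite :=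
  finite_weightBall c i le_rfl one_pos (fun _ => le_rfl) (fun _ _ => by norm_num) _

theorem spinBall_mono {p : ℕ} {D : Type} [AddCommGroup D] (c : ℕ → D →+ ZMod p) (i : ℕ)
    {k l : ℕ} (h : k ≤ l) : spinBall c i k ⊆ spinBall c i l :=
  weightBall_mono c i _ (by exact_mod_cast h)

theorem spinBall_mul {p : ℕ} {D : Type} [AddCommGroup D] {c : ℕ → D →+ ZMod p} {i k l : ℕ}
    {g h : Equiv.Perm (List (ZMod p))} (hg : g ∈ spinBall c i k) (hh : h ∈ spinBall c i l) :
    g * h ∈ spinBall c i (k + l) := by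
  have := weightBall_mul c i hg hh
  rwa [← Nat.cast_add] at this

theorem rot_mem_spinBall {p : ℕ} {D : Type} [AddCommGroup D] (c : ℕ → D →+ ZMod p) (i k : ℕ)
    (a : ZMod p) : rot a ∈ spinBall c i k :=
  syllable_mem_weightBall c i (Sum.inr a) (by simp)

theorem spin_mem_spinBall {p : ℕ} {D : Type} [AddCommGroup D] (c : ℕ → D →+ ZMod p) (i : ℕ)
    (d : D) : spin c i d ∈ spinBall c i 1 :=
  syllable_mem_weightBall c i (Sum.inl d) (by simp)

theorem list_prod_mem_spinBall {p : ℕ} {D : Type} [AddCommGroup D] {c : ℕ → D →+ ZMod p}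
    {i k : ℕ} {ι : Type} (l : List ι) {g : ι → Equiv.Perm (List (ZMod p))}
    (h : ∀ x, g x ∈ spinBall c i k) : (l.map g).prod ∈ spinBall c i (l.length * k) := by
  induction l with
  | nil => simpa [rot_zero] using rot_mem_spinBall c i 0 0
  | cons x l ih =>
    rw [List.map_cons, List.prod_cons, List.length_cons, add_mul, one_mul, add_comm]
    exact spinBall_mul (h x) ih

theorem rot_conj {p : ℕ} (F : ZMod p → Equiv.Perm (List (ZMod p))) (a : ZMod p) :
    rot a * wreath F 1 * rot (-a) = wreath (fun y => F (y - a)) 1 := by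
  rw [rot_eq, rot_eq, wreath_mul, wreath_mul]
  simp [← sigmaPow_add, sigmaPow_zero, sigmaPow_apply, sub_eq_add_neg]

/-- The element of the first level stabilizer with section `h` at `0`, and the syllables `e`, `d`
at `1` and `-1`. -/
def lift {p : ℕ} {D : Type} [AddCommGroup D] (c : ℕ → D →+ ZMod p) (i : ℕ)
    (h : Equiv.Perm (List (ZMod p))) (e : ZMod p) (d : D) : Equiv.Perm (List (ZMod p)) :=
  wreath (fun x => if x = 0 then h else if x = 1 then rot e
    else if x = -1 then spin c i d else 1) 1

theorem lift_mul {p : ℕ} {D : Type} [AddCommGroup D] (c : ℕ → D →+ ZMod p) (i : ℕ)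
    (h h' : Equiv.Perm (List (ZMod p))) (e e' : ZMod p) (d d' : D) :
    lift c i h e d * lift c i h' e' d' = lift c i (h * h') (e + e') (d + d') := by
  rw [lift, lift, lift, wreath_mul]
  congr 1
  funext x
  simp only [Equiv.Perm.one_apply]
  by_cases h0 : x = 0
  · simp [h0]
  · by_cases h1 : x = 1
    · subst h1
      simp [h0, rot_add]
    · by_cases h2 : x = -1
      · subst h2
        simp [h0, h1, spin_add]
      · simp [h0, h1, h2]

/-- Each syllable lifts at the cost of one spinal syllable. `spin c i d` has the spinal section at
`0` and a rotation at `1`; its conjugate by `rot (-1)` has the rotation at `0` and the spinal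
section at `-1`, and surjectivity of `c i` yields every rotation. As `p > 2`, the letters `0`, `1`,
`-1` are distinct, so lifts multiply coordinatewise. An alternating form with `k` pairs and a
leading rotation needs `2k + 1` lifts. -/
theorem exists_lift {p : ℕ} [Fact p.Prime] (hp : 2 < p) {D : Type} [AddCommGroup D]
    (c : ℕ → D →+ ZMod p) (hc : ∀ i, Function.Surjective (c i)) {i k : ℕ}
    {h : Equiv.Perm (List (ZMod p))} (hh : h ∈ spinBall c (i + 1) k) :
    ∃ e d, lift c (i + 1) h e d ∈ spinBall c i (2 * k + 1) := by
  have h2 : Fact (2 < p) := ⟨hp⟩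
  have hneg : (-1 : ZMod p) ≠ 1 := ZMod.neg_one_ne_one
  have key_rot : ∀ a, ∃ e d, lift c (i + 1) (rot a) e d ∈ spinBall c i 1 := by
    intro a
    obtain ⟨d, rfl⟩ := hc i a
    refine ⟨0, d, ?_⟩
    have : lift c (i + 1) (rot (c i d)) 0 d = rot (-1) * spin c i d * rot (-(-1)) := by
      rw [spin_eq c i d, rot_conj, lift]
      congr 1
      funext x
      by_cases h0 : x = 0
      · simp [h0]
      · by_cases h1 : x = 1
        · subst h1
          have : (1 + 1 : ZMod p) ≠ 0 := fun h => hneg (neg_eq_of_add_eq_zero_left h)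
          simp [rot_zero, this]
        · by_cases h3 : x = -1
          · subst h3
            simp [hneg]
          · have : x + 1 ≠ 0 := fun h => h3 (eq_neg_of_add_eq_zero_left h)
            simp [h0, h1, h3, this]
    rw [this]
    exact spinBall_mul (k := 1) (l := 0) (spinBall_mul (k := 0) (l := 1)
      (rot_mem_spinBall c i 0 _) (spin_mem_spinBall c i d)) (rot_mem_spinBall c i 0 _)
  have key_spin : ∀ d, lift c (i + 1) (spin c (i + 1) d) (c i d) 0 ∈ spinBall c i 1 := by
    intro d
    have : lift c (i + 1) (spin c (i + 1) d) (c i d) 0 = spin c i d := by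
      rw [spin_eq c i d, lift]
      simp [spin_zero]
    rw [this]
    exact spin_mem_spinBall c i d
  obtain ⟨L, hL, rfl⟩ := hh
  obtain ⟨a, M, h1, hM⟩ := exists_altProd c (i + 1) le_rfl (τ := fun _ => 1)
    (fun _ => zero_le_one) (fun _ _ => by norm_num) L
  have hk : M.length ≤ k := by
    have := hM.trans (add_le_add_left hL 0)
    simp only [zero_add, List.map_const', List.sum_replicate, add_zero, nsmul_eq_mul,
      mul_one] at this
    exact_mod_cast this
  have key_alt : ∃ e d, lift c (i + 1) (altProd c (i + 1) M) e d ∈ spinBall c i (2 * M.length) := by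
    clear hM h1 hk
    induction M with
    | nil =>
      refine ⟨0, 0, ?_⟩
      have : lift c (i + 1) (altProd c (i + 1) []) 0 0 = rot 0 := by
        simp [lift, altProd, rot_zero, spin_zero, wreath_one]
      rw [this]
      exact rot_mem_spinBall c i _ 0
    | cons m M ih =>
      obtain ⟨e, d, h⟩ := ih
      obtain ⟨e', d', h'⟩ := key_rot m.2
      refine ⟨c i m.1 + e' + e, 0 + d' + d, ?_⟩
      rw [altProd_cons, ← lift_mul, ← lift_mul]
      have := spinBall_mul (spinBall_mul (key_spin m.1) h') h
      rwa [show 1 + 1 + 2 * M.length = 2 * (m :: M).length by simp; ring] at this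
  obtain ⟨e, d, h⟩ := key_alt
  obtain ⟨e', d', h'⟩ := key_rot a
  refine ⟨e' + e, d' + d, ?_⟩
  rw [h1, ← lift_mul]
  exact spinBall_mono c i (by omega) (spinBall_mul h' h)

/-- The root permutation of a rotated lift recovers the rotation, and its section at `0` recovers
the lifted element. This crude estimate serves to make balls large uniformly in `i`, which starts
the sharper recursion. -/
theorem prime_mul_ncard_spinBall_le {p : ℕ} [Fact p.Prime] (hp : 2 < p) {D : Type}
    [AddCommGroup D] [Finite D] (c : ℕ → D →+ ZMod p) (hc : ∀ i, Function.Surjective (c i))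
    (i k : ℕ) : p * (spinBall c (i + 1) k).ncard ≤ (spinBall c i (2 * k + 1)).ncard := by
  choose e d hed using fun h : spinBall c (i + 1) k => exists_lift hp c hc h.2
  have : Finite (spinBall c i (2 * k + 1)) := finite_spinBall c i _
  let f : ZMod p × spinBall c (i + 1) k → spinBall c i (2 * k + 1) := fun q =>
    ⟨rot q.1 * lift c (i + 1) q.2 (e q.2) (d q.2), by
      simpa using spinBall_mul (rot_mem_spinBall c i 0 q.1) (hed q.2)⟩
  have hf : Function.Injective f := by
    rintro ⟨a, h⟩ ⟨b, h'⟩ hab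
    have h1 := congrArg Subtype.val hab
    simp only [f, rot_eq, lift, wreath_mul] at h1
    obtain ⟨h2, h3⟩ := wreath_inj h1
    have h4 := congrFun h2 0
    simp only [if_true, one_mul] at h4
    have h5 : a = b := sigmaPow_injective (by simpa using h3)
    rw [h5, Subtype.ext h4]
  have := Nat.card_le_card_of_injective f hf
  simpa [Nat.card_prod, Nat.card_zmod] using this

/-- Common factors cancel from both sides of the single position where the products may differ. -/
theorem eq_of_list_prod_eq {G ι : Type} [Group G] {f g : ι → G} {l : List ι} (hl : l.Nodup)
    {y : ι} (hy : y ∈ l) (hfg : ∀ x, x ≠ y → f x = g x)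
    (h : (l.map f).prod = (l.map g).prod) : f y = g y := by
  induction l with
  | nil => simp at hy
  | cons x l ih =>
    rw [List.nodup_cons] at hl
    rw [List.map_cons, List.map_cons, List.prod_cons, List.prod_cons] at h
    by_cases hxy : x = y
    · subst hxy
      have : l.map f = l.map g := List.map_congr_left fun z hz =>
        hfg z fun hzx => hl.1 (hzx ▸ hz)
      rw [this] at h
      exact mul_right_cancel h
    · rw [hfg x hxy] at h
      exact ih hl.2 ((List.mem_cons.mp hy).resolve_left (Ne.symm hxy)) (mul_left_cancel h)

/-- Conjugate the lift of `h x` by `rot x` and multiply over all `x`. The section of the product at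
`y` contains `h y` once; its other factors depend only on the side syllables `e`, `d` of the
remaining lifts. Hence the product together with the side syllables determines the tuple, and there
are `(p * Nat.card D) ^ p` choices of side syllables. -/
theorem ncard_spinBall_pow_le {p : ℕ} [Fact p.Prime] (hp : 2 < p) {D : Type}
    [AddCommGroup D] [Finite D] (c : ℕ → D →+ ZMod p) (hc : ∀ i, Function.Surjective (c i))
    (i k : ℕ) : (spinBall c (i + 1) k).ncard ^ p ≤
      (p * Nat.card D) ^ p * (spinBall c i (p * (2 * k + 1))).ncard := by
  choose e d hed using fun h : spinBall c (i + 1) k => exists_lift hp c hc h.2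
  have : Finite (spinBall c i (p * (2 * k + 1))) := finite_spinBall c i _
  have : Finite (spinBall c (i + 1) k) := finite_spinBall c _ _
  let l : List (ZMod p) := Finset.univ.toList
  have hlen : l.length = p := by simp [l, ZMod.card]
  -- `F h x y` is the section at `y` of the lift of `h x` conjugated by `rot x`.
  let F : (ZMod p → spinBall c (i + 1) k) → ZMod p → ZMod p → Equiv.Perm (List (ZMod p)) :=
    fun h x y => if y - x = 0 then h x else if y - x = 1 then rot (e (h x))
      else if y - x = -1 then spin c (i + 1) (d (h x)) else 1
  have hF : ∀ h x, wreath (F h x) 1 ∈ spinBall c i (2 * k + 1) := by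
    intro h x
    have := rot_conj (fun y => if y = 0 then (h x : Equiv.Perm (List (ZMod p)))
      else if y = 1 then rot (e (h x)) else if y = -1 then spin c (i + 1) (d (h x)) else 1) x
    rw [← this]
    have := spinBall_mul (spinBall_mul (rot_mem_spinBall c i 0 x) (hed (h x)))
      (rot_mem_spinBall c i 0 (-x))
    rwa [zero_add] at this
  have hprod : ∀ h (l : List (ZMod p)), (l.map fun x => wreath (F h x) 1).prod =
      wreath (fun y => (l.map fun x => F h x y).prod) 1 := by
    intro h l
    induction l with
    | nil => simp [wreath_one]
    | cons x l ih => simp [ih, wreath_mul]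
  let f : (ZMod p → spinBall c (i + 1) k) →
      (ZMod p → ZMod p × D) × spinBall c i (p * (2 * k + 1)) := fun h =>
    (fun x => (e (h x), d (h x)), ⟨(l.map fun x => wreath (F h x) 1).prod, by
      have := list_prod_mem_spinBall l (hF h)
      rwa [hlen] at this⟩)
  have hf : Function.Injective f := by
    intro h h' hh
    have h1 := congrFun (congrArg Prod.fst hh)
    have h2 := congrArg Subtype.val (congrArg Prod.snd hh)
    simp only [f] at h1 h2
    rw [hprod, hprod] at h2
    funext y
    have h3 := congrFun (wreath_inj h2).1 y
    have h4 := eq_of_list_prod_eq (f := fun x => F h x y) (g := fun x => F h' x y)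
      (Finset.nodup_toList _) (y := y) (by simp) (fun x hx => by
        have h5 : y - x ≠ 0 := fun h => hx (sub_eq_zero.mp h).symm
        have h6 := Prod.mk.inj (h1 x)
        simp only [F, h5, if_false, h6.1, h6.2]) h3
    simp only [F, sub_self, if_true] at h4
    exact Subtype.ext h4
  have := Nat.card_le_card_of_injective f hf
  simpa [Nat.card_prod, Nat.card_fun, Nat.card_zmod, Nat.card_coe_set_eq] using this

theorem prime_pow_le_ncard_spinBall {p : ℕ} [Fact p.Prime] (hp : 2 < p) {D : Type}
    [AddCommGroup D] [Finite D] (c : ℕ → D →+ ZMod p) (hc : ∀ i, Function.Surjective (c i))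
    (m i : ℕ) : p ^ m ≤ (spinBall c i (2 ^ m - 1)).ncard := by
  induction m generalizing i with
  | zero =>
    simp only [pow_zero, le_refl, tsub_eq_zero_of_le]
    exact (Set.ncard_pos (finite_spinBall c i 0)).mpr ⟨_, rot_mem_spinBall c i 0 0⟩
  | succ m ih =>
    have h1 := prime_mul_ncard_spinBall_le hp c hc i (2 ^ m - 1)
    have h2 : 2 * (2 ^ m - 1) + 1 = 2 ^ (m + 1) - 1 := by
      have := Nat.one_le_two_pow (n := m)
      rw [pow_succ]
      omega
    rw [h2] at h1
    rw [pow_succ, mul_comm]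
    exact (Nat.mul_le_mul_left p (ih (i + 1))).trans h1

/-- The balls grow without bound, uniformly in the starting index. -/
theorem exists_le_ncard_spinBall {p : ℕ} [Fact p.Prime] (hp : 2 < p) {D : Type}
    [AddCommGroup D] [Finite D] (c : ℕ → D →+ ZMod p) (hc : ∀ i, Function.Surjective (c i))
    (B : ℕ) : ∃ k₀, 1 ≤ k₀ ∧ ∀ k, k₀ ≤ k → ∀ i, B ≤ (spinBall c i k).ncard := by
  refine ⟨2 ^ (B + 1) - 1, ?_, fun k hk i => ?_⟩
  · have := Nat.one_lt_two_pow (n := B + 1) (by omega)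
    omega
  · calc B ≤ p ^ (B + 1) := by
          have := Nat.lt_pow_self (n := B + 1) (show 1 < p by omega)
          omega
      _ ≤ _ := prime_pow_le_ncard_spinBall hp c hc (B + 1) i
      _ ≤ _ := Set.ncard_le_ncard (spinBall_mono c i hk) (finite_spinBall c i k)

/-- Powers of the growth are dominated, at the expense of a shift of the index. -/
theorem exists_ncard_spinBall_pow_le {p : ℕ} [Fact p.Prime] (hp : 2 < p) {D : Type}
    [AddCommGroup D] [Finite D] (c : ℕ → D →+ ZMod p) (hc : ∀ i, Function.Surjective (c i))
    (m : ℕ) : ∃ k₀ C : ℕ, ∀ k, k₀ ≤ k → ∀ i,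
      (spinBall c (i + m) k).ncard ^ 2 ^ m ≤ (spinBall c i (C * k)).ncard := by
  obtain ⟨k₀, hk₀, hB⟩ := exists_le_ncard_spinBall hp c hc ((p * Nat.card D) ^ p)
  have hmono : ∀ i k l, k ≤ l → (spinBall c i k).ncard ≤ (spinBall c i l).ncard :=
    fun i k l h => Set.ncard_le_ncard (spinBall_mono c i h) (finite_spinBall c i l)
  have hstep : ∀ k, k₀ ≤ k → ∀ i,
      (spinBall c (i + 1) k).ncard ^ 2 ≤ (spinBall c i (3 * p * k)).ncard := by
    intro k hk i
    have h1 := ncard_spinBall_pow_le hp c hc i k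
    have h2 := hB k hk (i + 1)
    have h4 : 1 ≤ (spinBall c (i + 1) k).ncard :=
      (Set.ncard_pos (finite_spinBall c _ k)).mpr ⟨_, rot_mem_spinBall c _ k 0⟩
    -- Since `p ≥ 3`, one of the `p` factors can be spent on the constant `(p * Nat.card D) ^ p`,
    -- leaving a square.
    have h3 : (spinBall c (i + 1) k).ncard * (spinBall c (i + 1) k).ncard ^ 2 ≤
        (spinBall c (i + 1) k).ncard * (spinBall c i (p * (2 * k + 1))).ncard := by
      calc _ = (spinBall c (i + 1) k).ncard ^ 3 := by ring
        _ ≤ (spinBall c (i + 1) k).ncard ^ p := Nat.pow_le_pow_right h4 hp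
        _ ≤ _ := h1
        _ ≤ _ := Nat.mul_le_mul_right _ h2
    refine (Nat.le_of_mul_le_mul_left h3 h4).trans (hmono _ _ _ ?_)
    have : 2 * k + 1 ≤ 3 * k := by omega
    calc p * (2 * k + 1) ≤ p * (3 * k) := Nat.mul_le_mul_left p this
      _ = 3 * p * k := by ring
  refine ⟨k₀, (3 * p) ^ m, ?_⟩
  have hp3 : 1 ≤ 3 * p := by omega
  induction m with
  | zero => simp
  | succ m ih =>
    intro k hk i
    have h1 := hstep k hk (i + m)
    have h2 := ih (3 * p * k) (hk.trans (Nat.le_mul_of_pos_left k hp3)) i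
    calc (spinBall c (i + (m + 1)) k).ncard ^ 2 ^ (m + 1)
        = ((spinBall c (i + m + 1) k).ncard ^ 2) ^ 2 ^ m := by
          rw [← pow_mul, pow_succ', add_assoc]
      _ ≤ (spinBall c (i + m) (3 * p * k)).ncard ^ 2 ^ m := Nat.pow_le_pow_left h1 _
      _ ≤ _ := h2
      _ = _ := by rw [pow_succ, mul_assoc ((3 * p) ^ m)]

theorem exp_rpow_le_ncard_spinBall {p : ℕ} [Fact p.Prime] (hp : 2 < p) {D : Type}
    [AddCommGroup D] [Finite D] (c : ℕ → D →+ ZMod p) (hc : ∀ i, Function.Surjective (c i)) :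
    ∃ C : ℕ, ∀ n i : ℕ, Real.exp ((n : ℝ) ^ (Real.log p / (Real.log p + Real.log 2))) ≤
      ((spinBall c i (C * n)).ncard : ℝ) := by
  set B := (p * Nat.card D) ^ p with hB
  obtain ⟨k₀, -, hk₀⟩ := exists_le_ncard_spinBall hp c hc (B * 3)
  have hmono : ∀ i k l, k ≤ l → (spinBall c i k).ncard ≤ (spinBall c i l).ncard :=
    fun i k l h => Set.ncard_le_ncard (spinBall_mono c i h) (finite_spinBall c i l)
  have hBpos : 1 ≤ B := Nat.one_le_pow _ _ (Nat.mul_pos (by omega) Nat.card_pos)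
  -- Carrying the factor `B` makes the estimate self-reproducing: `B ^ p ≥ B ^ 2`, and one `B`
  -- cancels against the constant of the recursion. Bounding `k + 1` instead of `k` turns `k ↦ p(2k
  -- + 1)` into multiplication by at most `2p`.
  have key : ∀ m, ∃ k, k + 1 ≤ (2 * p) ^ m * (k₀ + 1) ∧
      ∀ i, B * 3 ^ p ^ m ≤ (spinBall c i k).ncard := by
    intro m
    induction m with
    | zero => exact ⟨k₀, by simp, fun i => by simpa using hk₀ k₀ le_rfl i⟩
    | succ m ih =>
      obtain ⟨k, h1, h2⟩ := ih
      refine ⟨p * (2 * k + 1), ?_, fun i => ?_⟩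
      · calc p * (2 * k + 1) + 1 ≤ 2 * p * (k + 1) := by
              have : 1 ≤ p := by omega
              linarith
          _ ≤ 2 * p * ((2 * p) ^ m * (k₀ + 1)) := Nat.mul_le_mul_left _ h1
          _ = _ := by ring
      · have h3 := ncard_spinBall_pow_le hp c hc i k
        have h4 : B * (B * 3 ^ p ^ (m + 1)) ≤ B * (spinBall c i (p * (2 * k + 1))).ncard := by
          calc B * (B * 3 ^ p ^ (m + 1)) = B ^ 2 * (3 ^ p ^ m) ^ p := by
                rw [pow_succ p m, pow_mul]; ring
            _ ≤ B ^ p * (3 ^ p ^ m) ^ p :=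
                Nat.mul_le_mul_right _ (Nat.pow_le_pow_right hBpos (by omega))
            _ = (B * 3 ^ p ^ m) ^ p := (mul_pow _ _ _).symm
            _ ≤ _ := (Nat.pow_le_pow_left (h2 (i + 1)) p).trans h3
        exact Nat.le_of_mul_le_mul_left h4 hBpos
  have hp0 : (0 : ℝ) < p := by exact_mod_cast (by omega : 0 < p)
  have hlogp : 0 < Real.log p := Real.log_pos (by exact_mod_cast (by omega : 1 < p))
  have hlog2 : 0 < Real.log 2 := Real.log_pos (by norm_num)
  set α := Real.log p / (Real.log p + Real.log 2) with hα
  have hαpos : 0 < α := by positivity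
  have hpow : ((2 * p : ℕ) : ℝ) ^ α = p := by
    rw [Real.rpow_def_of_pos (by positivity)]
    push_cast
    rw [Real.log_mul (by norm_num) hp0.ne', hα, add_comm (Real.log 2),
      mul_div_cancel₀ _ (by positivity), Real.exp_log hp0]
  refine ⟨2 * p * (k₀ + 1), fun n i => ?_⟩
  rcases Nat.eq_zero_or_pos n with rfl | hn
  · have h1 : 1 ≤ (spinBall c i (2 * p * (k₀ + 1) * 0)).ncard :=
      (Set.ncard_pos (finite_spinBall c i _)).mpr ⟨_, rot_mem_spinBall c i _ 0⟩
    simpa [Real.zero_rpow hαpos.ne'] using h1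
  -- The least power of `2p` exceeding `n`; it overshoots `n` by at most a factor `2p`.
  set m := Nat.log (2 * p) n + 1
  have h1 : n ≤ (2 * p) ^ m := (Nat.lt_pow_succ_log_self (by omega) n).le
  have h2 : (2 * p) ^ m ≤ 2 * p * n := by
    rw [pow_succ, mul_comm]
    exact Nat.mul_le_mul_left _ (Nat.pow_log_le_self _ hn.ne')
  obtain ⟨k, hk, h3⟩ := key m
  have h4 : (n : ℝ) ^ α ≤ (p : ℝ) ^ m := by
    calc (n : ℝ) ^ α ≤ (((2 * p) ^ m : ℕ) : ℝ) ^ α :=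
          Real.rpow_le_rpow (by positivity) (by exact_mod_cast h1) hαpos.le
      _ = (((2 * p : ℕ) : ℝ) ^ α) ^ m := by
          rw [Nat.cast_pow, ← Real.rpow_natCast, ← Real.rpow_natCast, ← Real.rpow_mul (by positivity),
            ← Real.rpow_mul (by positivity), mul_comm α]
      _ = _ := by rw [hpow]
  have h5 : k ≤ 2 * p * (k₀ + 1) * n := by
    calc k ≤ (2 * p) ^ m * (k₀ + 1) := by omega
      _ ≤ 2 * p * n * (k₀ + 1) := Nat.mul_le_mul_right _ h2
      _ = _ := by ring
  calc Real.exp ((n : ℝ) ^ α) ≤ Real.exp ((p : ℝ) ^ m) := Real.exp_le_exp.mpr h4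
    _ = Real.exp 1 ^ p ^ m := by
        rw [← Real.exp_nat_mul, mul_one, Nat.cast_pow]
    _ ≤ (3 : ℝ) ^ p ^ m := by
        gcongr
        exact Real.exp_one_lt_d9.le.trans (by norm_num)
    _ ≤ ((B * 3 ^ p ^ m : ℕ) : ℝ) := by
        push_cast
        exact le_mul_of_one_le_left (by positivity) (by exact_mod_cast hBpos)
    _ ≤ _ := by exact_mod_cast (h3 i).trans (hmono i _ _ h5)

/-! ### Upper bounds -/

/-- The first index `k` with `c (i + k) d = 0`. -/
noncomputable def firstZero {p : ℕ} {D : Type} [AddCommGroup D] (c : ℕ → D →+ ZMod p) (i : ℕ)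
    (d : D) : ℕ :=
  sInf {k | c (i + k) d = 0}

/-- The weight of a spinal syllable, for windows of length `R` and contraction `y`. -/
noncomputable def spinWeight {p : ℕ} {D : Type} [AddCommGroup D] (c : ℕ → D →+ ZMod p) (R : ℕ)
    (y : ℝ) (i : ℕ) (d : D) : ℝ :=
  y ^ (R - 1 - firstZero c i d) + y ^ R - 1

/-- The ball of radius `t` for the weights `spinWeight` and `1 - y ^ R`. -/
noncomputable def contractingBall {p : ℕ} {D : Type} [AddCommGroup D] (c : ℕ → D →+ ZMod p)
    (R : ℕ) (y : ℝ) (i : ℕ) (t : ℝ) : Set (Equiv.Perm (List (ZMod p))) :=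
  weightBall c i (Sum.elim (spinWeight c R y i) fun _ => 1 - y ^ R) t

theorem firstZero_spec {p : ℕ} {D : Type} [AddCommGroup D] {c : ℕ → D →+ ZMod p} {R : ℕ}
    (hR : ∀ i d, ∃ k < R, c (i + k) d = 0) (i : ℕ) (d : D) :
    c (i + firstZero c i d) d = 0 := by
  obtain ⟨k, -, hk⟩ := hR i d
  exact Nat.sInf_mem (s := {k | c (i + k) d = 0}) ⟨k, hk⟩

theorem firstZero_le {p : ℕ} {D : Type} [AddCommGroup D] {c : ℕ → D →+ ZMod p} {i k : ℕ} {d : D}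
    (h : c (i + k) d = 0) : firstZero c i d ≤ k :=
  Nat.sInf_le h

theorem firstZero_lt {p : ℕ} {D : Type} [AddCommGroup D] {c : ℕ → D →+ ZMod p} {R : ℕ}
    (hR : ∀ i d, ∃ k < R, c (i + k) d = 0) (i : ℕ) (d : D) : firstZero c i d < R := by
  obtain ⟨k, hk, h⟩ := hR i d
  exact (firstZero_le h).trans_lt hk

theorem spinWeight_le {p : ℕ} {D : Type} [AddCommGroup D] (c : ℕ → D →+ ZMod p) (R : ℕ)
    {y : ℝ} (hy0 : 0 < y) (hy1 : y < 1) (i : ℕ) (d : D) : spinWeight c R y i d ≤ y ^ R := by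
  have := pow_le_one₀ hy0.le hy1.le (n := R - 1 - firstZero c i d)
  rw [spinWeight]
  linarith

theorem le_spinWeight {p : ℕ} {D : Type} [AddCommGroup D] (c : ℕ → D →+ ZMod p) (R : ℕ)
    {y : ℝ} (hy0 : 0 < y) (hy1 : y < 1) (i : ℕ) (d : D) (k : ℕ) (hk : k ≤ firstZero c i d) :
    y ^ (R - 1 - k) + y ^ R - 1 ≤ spinWeight c R y i d := by
  have := pow_le_pow_of_le_one hy0.le hy1.le
    (show R - 1 - firstZero c i d ≤ R - 1 - k by omega)
  rw [spinWeight]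
  linarith

theorem spinWeight_pos_bound {R : ℕ} (hR2 : 3 ≤ R) {y : ℝ} (hy0 : 0 < y) (hy1 : y < 1)
    (hy : 2 ≤ y ^ R + y ^ (R - 1) + y ^ (R - 2)) : 0 < y ^ (R - 1) + y ^ R - 1 := by
  have : y ^ (R - 2) < 1 := pow_lt_one₀ hy0.le hy1 (by omega)
  linarith

/-- If the first zeros of `d` and `e` coincide, then `d + e` vanishes there too and weighs at most
as much as `d`. Otherwise one of the two first zeros is at least `1`, so the weights add up to at
least `y^(R-1) + y^(R-2) + 2y^R - 2`. By the condition on `y` this is at least `y^R`, the maximal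
weight. -/
theorem spinWeight_add_le {p : ℕ} {D : Type} [AddCommGroup D] {c : ℕ → D →+ ZMod p} {R : ℕ}
    (hR : ∀ i d, ∃ k < R, c (i + k) d = 0) (hR2 : 3 ≤ R)
    {y : ℝ} (hy0 : 0 < y) (hy1 : y < 1) (hy : 2 ≤ y ^ R + y ^ (R - 1) + y ^ (R - 2))
    (i : ℕ) (d e : D) :
    spinWeight c R y i (d + e) ≤ spinWeight c R y i d + spinWeight c R y i e := by
  have hpos := spinWeight_pos_bound hR2 hy0 hy1 hy
  have h0 : ∀ d, y ^ (R - 1) + y ^ R - 1 ≤ spinWeight c R y i d := fun d => by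
    simpa using le_spinWeight c R hy0 hy1 i d 0 (Nat.zero_le _)
  have h1 : ∀ d, 1 ≤ firstZero c i d → y ^ (R - 2) + y ^ R - 1 ≤ spinWeight c R y i d :=
    fun d hd => by simpa [Nat.sub_sub] using le_spinWeight c R hy0 hy1 i d 1 hd
  have hle := spinWeight_le c R hy0 hy1 i (d + e)
  rcases lt_trichotomy (firstZero c i d) (firstZero c i e) with h | h | h
  · linarith [h0 d, h1 e (by omega)]
  · have h2 : firstZero c i (d + e) ≤ firstZero c i d := by
      apply firstZero_le
      rw [map_add, firstZero_spec hR i d, h, firstZero_spec hR i e, add_zero]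
    have h3 := le_spinWeight c R hy0 hy1 i d _ h2
    rw [← spinWeight] at h3
    linarith [h0 e]
  · linarith [h0 e, h1 d (by omega)]

/-- Passing to the sections of a spinal syllable contracts the weight by the factor `y`. -/
theorem spinWeight_contract {p : ℕ} {D : Type} [AddCommGroup D] {c : ℕ → D →+ ZMod p} {R : ℕ}
    (hR : ∀ i d, ∃ k < R, c (i + k) d = 0) (hR2 : 3 ≤ R)
    {y : ℝ} (hy0 : 0 < y) (hy1 : y < 1) (i : ℕ) (d : D) :
    spinWeight c R y (i + 1) d + (if c i d = 0 then 0 else 1 - y ^ R) ≤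
      y * (1 - y ^ R + spinWeight c R y i d) := by
  have hlt := firstZero_lt hR i d
  have hspec := firstZero_spec hR i d
  have heq : y * (1 - y ^ R + spinWeight c R y i d) = y ^ (R - firstZero c i d) := by
    rw [spinWeight, show R - firstZero c i d = (R - 1 - firstZero c i d) + 1 by omega, pow_succ]
    ring
  rw [heq]
  split_ifs with h
  · have h0 : firstZero c i d = 0 := Nat.le_zero.mp (firstZero_le (by simpa using h))
    rw [h0, add_zero, Nat.sub_zero]
    exact spinWeight_le c R hy0 hy1 _ d
  -- When `c i d ≠ 0`, raising the index lowers the first zero by exactly one and the contraction is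
  -- an equality; the weights are designed for this.
  · have h1 : firstZero c i d ≠ 0 := fun h0 => h (by simpa [h0] using hspec)
    have h2 : firstZero c (i + 1) d ≤ firstZero c i d - 1 := by
      apply firstZero_le
      rwa [show i + 1 + (firstZero c i d - 1) = i + firstZero c i d by omega]
    have h3 : firstZero c i d ≤ firstZero c (i + 1) d + 1 := by
      apply firstZero_le
      have := firstZero_spec hR (i + 1) d
      rwa [add_assoc, add_comm 1] at this
    rw [spinWeight, show R - 1 - firstZero c (i + 1) d = R - firstZero c i d by omega]
    linarith

/-- Each spinal syllable sends itself to one letter and its rotation to another. Rotations only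
permute the letters that receive these sections, so the sum over all letters is unaffected and
`spinWeight_contract` applies pair by pair. -/
theorem exists_sections {p : ℕ} [Fact p.Prime] {D : Type} [AddCommGroup D]
    {c : ℕ → D →+ ZMod p} {R : ℕ}
    (hR : ∀ i d, ∃ k < R, c (i + k) d = 0) (hR2 : 3 ≤ R)
    {y : ℝ} (hy0 : 0 < y) (hy1 : y < 1) (i : ℕ) (M : List (D × ZMod p)) :
    ∃ (f : ZMod p → List (D ⊕ ZMod p)) (a : ZMod p),
      altProd c i M = wreath (fun x => ((f x).map (syllable c (i + 1))).prod) (sigmaPow a) ∧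
      ∑ x, ((f x).map (Sum.elim (spinWeight c R y (i + 1)) fun _ => 1 - y ^ R)).sum ≤
        y * (M.map fun m => 1 - y ^ R + spinWeight c R y i m.1).sum := by
  induction M with
  | nil =>
    refine ⟨fun _ => [], 0, ?_, by simp⟩
    simp [altProd, sigmaPow_zero, wreath_one]
  | cons m M ih =>
    obtain ⟨f, a, h1, h2⟩ := ih
    obtain ⟨d, b⟩ := m
    -- A trivial rotation is omitted rather than recorded, since it would still cost `1 - y ^ R`.
    let s : ZMod p → List (D ⊕ ZMod p) := fun x =>
      if x = 0 then [Sum.inl d] else if x = 1 ∧ c i d ≠ 0 then [Sum.inr (c i d)] else []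
    have hs : ∀ x, ((s x).map (syllable c (i + 1))).prod =
        if x = 0 then spin c (i + 1) d else if x = 1 then rot (c i d) else 1 := by
      intro x
      by_cases h0 : x = 0
      · simp [s, h0, syllable_inl]
      · by_cases h1 : x = 1
        · by_cases h2 : c i d = 0
          · simp [s, h2, rot_zero, h0]
          · simp [s, h2, h1, syllable_inr]
        · simp [s, h0, h1]
    have hw : ∑ x, ((s x).map (Sum.elim (spinWeight c R y (i + 1)) fun _ => 1 - y ^ R)).sum =
        spinWeight c R y (i + 1) d + (if c i d = 0 then 0 else 1 - y ^ R) := by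
      have : ∀ x, ((s x).map (Sum.elim (spinWeight c R y (i + 1)) fun _ => 1 - y ^ R)).sum =
          (if x = 0 then spinWeight c R y (i + 1) d else 0) +
            (if x = 1 then (if c i d = 0 then 0 else 1 - y ^ R) else 0) := by
        intro x
        by_cases h0 : x = 0
        · simp [s, h0]
        · by_cases h1 : x = 1
          · by_cases h2 : c i d = 0
            · simp [s, h2, h0]
            · simp [s, h2, h1]
          · simp [s, h0, h1]
      simp_rw [this, Finset.sum_add_distrib]
      simp
    refine ⟨fun x => s (sigmaPow (b + a) x) ++ f x, b + a, ?_, ?_⟩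
    · have hsd : spin c i d = wreath (fun x => ((s x).map (syllable c (i + 1))).prod) 1 := by
        rw [spin_eq]
        simp_rw [hs]
      rw [altProd_cons, h1, hsd, rot_eq, mul_assoc, wreath_mul, wreath_mul, one_mul, sigmaPow_add]
      simp
    · have h3 : ∑ x, ((s (sigmaPow (b + a) x)).map
          (Sum.elim (spinWeight c R y (i + 1)) fun _ => 1 - y ^ R)).sum = ∑ x, ((s x).map
          (Sum.elim (spinWeight c R y (i + 1)) fun _ => 1 - y ^ R)).sum :=
        Equiv.sum_comp (sigmaPow (b + a)) fun x => ((s x).map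
          (Sum.elim (spinWeight c R y (i + 1)) fun _ => 1 - y ^ R)).sum
      simp only [List.map_append, List.sum_append, Finset.sum_add_distrib, List.map_cons,
        List.sum_cons]
      rw [h3, hw, mul_add]
      exact add_le_add (spinWeight_contract hR hR2 hy0 hy1 i d) h2

theorem finite_contractingBall {p : ℕ} [Fact p.Prime] {D : Type} [AddCommGroup D] [Finite D]
    {c : ℕ → D →+ ZMod p} {R : ℕ}
    (hR : ∀ i d, ∃ k < R, c (i + k) d = 0) (hR2 : 3 ≤ R)
    {y : ℝ} (hy0 : 0 < y) (hy1 : y < 1) (hy : 2 ≤ y ^ R + y ^ (R - 1) + y ^ (R - 2))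
    (i : ℕ) (t : ℝ) : (contractingBall c R y i t).Finite :=
  finite_weightBall c i (sub_nonneg.mpr (pow_le_one₀ hy0.le hy1.le))
    (spinWeight_pos_bound hR2 hy0 hy1 hy)
    (fun d => by simpa using le_spinWeight c R hy0 hy1 i d 0 (Nat.zero_le _))
    (spinWeight_add_le hR hR2 hy0 hy1 hy i) t

theorem exists_ncard_contractingBall_le {p : ℕ} [Fact p.Prime] {D : Type} [AddCommGroup D]
    [Finite D] {c : ℕ → D →+ ZMod p} {R : ℕ}
    (hR : ∀ i d, ∃ k < R, c (i + k) d = 0) (hR2 : 3 ≤ R)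
    {y : ℝ} (hy0 : 0 < y) (hy1 : y < 1) (hy : 2 ≤ y ^ R + y ^ (R - 1) + y ^ (R - 2)) (t : ℝ) :
    ∃ Q : ℕ, ∀ i, (contractingBall c R y i t).ncard ≤ Q := by
  have hpos := spinWeight_pos_bound hR2 hy0 hy1 hy
  obtain ⟨K, hK⟩ := exists_nat_ge ((t + (1 - y ^ R)) / (y ^ (R - 1) + y ^ R - 1))
  rw [div_le_iff₀' hpos] at hK
  refine ⟨_, fun i => (Set.ncard_le_ncard (weightBall_subset_image c i
    (sub_nonneg.mpr (pow_le_one₀ hy0.le hy1.le)) hpos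
    (fun d => by simpa using le_spinWeight c R hy0 hy1 i d 0 (Nat.zero_le _))
    (spinWeight_add_le hR hR2 hy0 hy1 hy i) t K hK) ((finite_altForms p D K).image _)).trans
    (Set.ncard_image_le (finite_altForms p D K))⟩

theorem contractingBall_zero {p : ℕ} [Fact p.Prime] {D : Type} [AddCommGroup D]
    (c : ℕ → D →+ ZMod p) {R : ℕ} (hR2 : 3 ≤ R)
    {y : ℝ} (hy0 : 0 < y) (hy1 : y < 1) (hy : 2 ≤ y ^ R + y ^ (R - 1) + y ^ (R - 2)) (i : ℕ) :
    (contractingBall c R y i 0).ncard = 1 := by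
  have hpos := spinWeight_pos_bound hR2 hy0 hy1 hy
  rw [Set.ncard_eq_one]
  refine ⟨1, Set.Subset.antisymm ?_ (Set.singleton_subset_iff.mpr (one_mem_weightBall c i _ le_rfl))⟩
  rintro g ⟨L, h1, rfl⟩
  have h2 : ∀ s : D ⊕ ZMod p, 0 < Sum.elim (spinWeight c R y i) (fun _ => 1 - y ^ R) s := by
    rintro (d | a)
    · have := le_spinWeight c R hy0 hy1 i d 0 (Nat.zero_le _)
      rw [Nat.sub_zero] at this
      exact hpos.trans_le this
    · exact sub_pos.mpr (pow_lt_one₀ hy0.le hy1 (by omega))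
  rcases L with _ | ⟨s, L⟩
  · simp
  · have h3 : 0 ≤ (L.map (Sum.elim (spinWeight c R y i) fun _ => 1 - y ^ R)).sum := by
      apply List.sum_nonneg
      intro x hx
      obtain ⟨z, -, rfl⟩ := List.mem_map.mp hx
      exact (h2 z).le
    rw [List.map_cons, List.sum_cons] at h1
    linarith [h2 s]

/-- Every element of a ball is given by a rotation and a tuple of sections in smaller balls. -/
theorem contractingBall_decompose {p : ℕ} [Fact p.Prime] {D : Type} [AddCommGroup D]
    {c : ℕ → D →+ ZMod p} {R : ℕ}
    (hR : ∀ i d, ∃ k < R, c (i + k) d = 0) (hR2 : 3 ≤ R)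
    {y : ℝ} (hy0 : 0 < y) (hy1 : y < 1) (hy : 2 ≤ y ^ R + y ^ (R - 1) + y ^ (R - 2))
    {i n T : ℕ} (hT : y * (n + 1) + p ≤ T) {g : Equiv.Perm (List (ZMod p))}
    (hg : g ∈ contractingBall c R y i n) :
    ∃ (a : ZMod p) (ν : ZMod p → ℕ) (f : ZMod p → Equiv.Perm (List (ZMod p))), ∑ x, ν x ≤ T ∧
      (∀ x, f x ∈ contractingBall c R y (i + 1) (ν x)) ∧ g = wreath f (sigmaPow a) := by
  have hpos := spinWeight_pos_bound hR2 hy0 hy1 hy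
  have hyR : 0 ≤ 1 - y ^ R := sub_nonneg.mpr (pow_le_one₀ hy0.le hy1.le)
  have hw : ∀ i (d : D), 0 ≤ spinWeight c R y i d := fun i d => hpos.le.trans (by
    simpa using le_spinWeight c R hy0 hy1 i d 0 (Nat.zero_le _))
  obtain ⟨L, h1, rfl⟩ := hg
  obtain ⟨b, M, h2, h3⟩ := exists_altProd c i hyR (hw i)
    (spinWeight_add_le hR hR2 hy0 hy1 hy i) L
  obtain ⟨f, a, h4, h5⟩ := exists_sections hR hR2 hy0 hy1 i M
  -- Rounding radii up costs at most `1` per letter, which is the `p` in `hT`; the `1` in `n + 1`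
  -- covers the surplus `1 - y ^ R` of the alternating form.
  refine ⟨b + a, fun x => ⌈((f x).map (Sum.elim (spinWeight c R y (i + 1))
    fun _ => 1 - y ^ R)).sum⌉₊, fun x => ((f x).map (syllable c (i + 1))).prod, ?_,
    fun x => ⟨f x, Nat.le_ceil _, rfl⟩, ?_⟩
  · have h6 : ∀ x, 0 ≤ ((f x).map (Sum.elim (spinWeight c R y (i + 1))
        fun _ => 1 - y ^ R)).sum := by
      intro x
      apply List.sum_nonneg
      intro z hz
      obtain ⟨s, -, rfl⟩ := List.mem_map.mp hz
      rcases s with d | a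
      · exact hw _ d
      · exact hyR
    have h7 : ((∑ x, ⌈((f x).map (Sum.elim (spinWeight c R y (i + 1))
        fun _ => 1 - y ^ R)).sum⌉₊ : ℕ) : ℝ) ≤ T := by
      push_cast
      calc _ ≤ ∑ x, (((f x).map (Sum.elim (spinWeight c R y (i + 1))
            fun _ => 1 - y ^ R)).sum + 1) :=
            Finset.sum_le_sum fun x _ => (Nat.ceil_lt_add_one (h6 x)).le
        _ ≤ y * (M.map fun m => 1 - y ^ R + spinWeight c R y i m.1).sum + p := by
            rw [Finset.sum_add_distrib]
            simpa [ZMod.card] using h5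
        _ ≤ y * (n + 1) + p := by
            gcongr
            have : 0 < y ^ R := by positivity
            linarith
        _ ≤ T := hT
    exact_mod_cast h7
  · rw [h2, h4, rot_eq, wreath_mul, sigmaPow_add]
    simp

/-- Jensen's inequality for the concave function `x ↦ x ^ β`, with equal weights. -/
theorem sum_rpow_le {ι : Type} [Fintype ι] [Nonempty ι] {β : ℝ} (h0 : 0 < β) (h1 : β ≤ 1)
    {T : ℝ} (ν : ι → ℕ) (hν : ∑ x, (ν x : ℝ) ≤ T) :
    ∑ x, (ν x : ℝ) ^ β ≤ (Fintype.card ι : ℝ) ^ (1 - β) * T ^ β := by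
  have hc : (0 : ℝ) < Fintype.card ι := by exact_mod_cast Fintype.card_pos
  have h := (Real.concaveOn_rpow h0.le h1).le_map_sum (t := Finset.univ)
    (w := fun _ : ι => (Fintype.card ι : ℝ)⁻¹) (p := fun x => (ν x : ℝ))
    (fun _ _ => by positivity) (by simp [hc.ne']) (fun _ _ => Set.mem_Ici.mpr (by positivity))
  simp only [smul_eq_mul, ← Finset.mul_sum] at h
  rw [inv_mul_le_iff₀ hc] at h
  have hs : (0 : ℝ) ≤ ∑ x, (ν x : ℝ) := by positivity
  calc _ ≤ _ := h
    _ = (Fintype.card ι : ℝ) ^ (1 - β) * (∑ x, (ν x : ℝ)) ^ β := by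
        rw [Real.mul_rpow (by positivity) hs, Real.inv_rpow hc.le, Real.rpow_sub hc, Real.rpow_one]
        field_simp
    _ ≤ _ := by gcongr

/-- An element is determined by its rotation (`p` choices) and its sections. There are at most `(T +
1) ^ p` tuples of radii, and for each of them the product of the bounds `ih` is controlled by
`sum_rpow_le`. -/
theorem ncard_contractingBall_step {p : ℕ} [Fact p.Prime] {D : Type} [AddCommGroup D]
    [Finite D] {c : ℕ → D →+ ZMod p} {R : ℕ}
    (hR : ∀ i d, ∃ k < R, c (i + k) d = 0) (hR2 : 3 ≤ R)
    {y : ℝ} (hy0 : 0 < y) (hy1 : y < 1) (hy : 2 ≤ y ^ R + y ^ (R - 1) + y ^ (R - 2))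
    {i n T : ℕ} (hT : y * (n + 1) + p ≤ T) {β C : ℝ} (hβ0 : 0 < β) (hβ1 : β ≤ 1) (hC : 0 ≤ C)
    (ih : ∀ m ≤ T, ((contractingBall c R y (i + 1) m).ncard : ℝ) ≤ Real.exp (C * (m : ℝ) ^ β)) :
    ((contractingBall c R y i n).ncard : ℝ) ≤
      p * (T + 1) ^ p * Real.exp (C * ((p : ℝ) ^ (1 - β) * (T : ℝ) ^ β)) := by
  let I := ZMod p × {ν : ZMod p → Fin (T + 1) // ∑ x, (ν x : ℕ) ≤ T}
  have hfin : ∀ m : ℕ, Finite (contractingBall c R y (i + 1) m) := fun m =>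
    finite_contractingBall hR hR2 hy0 hy1 hy _ _
  let Z : I → Type := fun j => ∀ x, contractingBall c R y (i + 1) ((j.2.1 x : ℕ) : ℝ)
  let F : (Σ j : I, Z j) → Equiv.Perm (List (ZMod p)) := fun q =>
    wreath (fun x => (q.2 x : Equiv.Perm (List (ZMod p)))) (sigmaPow q.1.1)
  have hsub : contractingBall c R y i n ⊆ Set.range F := by
    intro g hg
    obtain ⟨a, ν, f, h1, h2, rfl⟩ := contractingBall_decompose hR hR2 hy0 hy1 hy hT hg
    have h3 : ∀ x, ν x < T + 1 := fun x =>
      Nat.lt_succ_of_le ((Finset.single_le_sum (fun _ _ => Nat.zero_le _)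
        (Finset.mem_univ x)).trans h1)
    exact ⟨⟨(a, ⟨fun x => ⟨ν x, h3 x⟩, h1⟩), fun x => ⟨f x, h2 x⟩⟩, rfl⟩
  have hcard : (contractingBall c R y i n).ncard ≤ Nat.card (Σ j : I, Z j) := by
    have hZ : ∀ j, Finite (Z j) := fun j => Pi.finite
    refine (Set.ncard_le_ncard hsub (Set.finite_range F)).trans ?_
    rw [← Nat.card_coe_set_eq]
    exact Finite.card_range_le F
  have hZcard : ∀ j : I, (Nat.card (Z j) : ℝ) ≤
      Real.exp (C * ((p : ℝ) ^ (1 - β) * (T : ℝ) ^ β)) := by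
    intro j
    have h1 : (Nat.card (Z j) : ℝ) =
        ∏ x, ((contractingBall c R y (i + 1) ((j.2.1 x : ℕ) : ℝ)).ncard : ℝ) := by
      simp only [Z, Nat.card_pi, Nat.card_coe_set_eq]
      push_cast
      rfl
    have h2 := sum_rpow_le hβ0 hβ1 (T := T) (fun x => (j.2.1 x : ℕ)) (by exact_mod_cast j.2.2)
    rw [ZMod.card] at h2
    rw [h1]
    calc _ ≤ ∏ x, Real.exp (C * ((j.2.1 x : ℕ) : ℝ) ^ β) :=
          Finset.prod_le_prod (fun _ _ => by positivity)
            fun x _ => ih _ (Nat.lt_succ_iff.mp (j.2.1 x).2)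
      _ = Real.exp (C * ∑ x, ((j.2.1 x : ℕ) : ℝ) ^ β) := by
          rw [← Real.exp_sum, Finset.mul_sum]
      _ ≤ _ := by gcongr
  have hI : (Nat.card I : ℝ) ≤ p * (T + 1) ^ p := by
    have h1 : Nat.card I ≤ p * (T + 1) ^ p := by
      simp only [I, Nat.card_prod, Nat.card_zmod]
      refine Nat.mul_le_mul_left p ((Finite.card_subtype_le _).trans ?_)
      simp
    exact_mod_cast h1
  have hZf : ∀ j, Finite (Z j) := fun j => Pi.finite
  have : Fintype I := Fintype.ofFinite I
  calc ((contractingBall c R y i n).ncard : ℝ) ≤ (Nat.card (Σ j : I, Z j) : ℝ) := by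
        exact_mod_cast hcard
    _ = ∑ j : I, (Nat.card (Z j) : ℝ) := by
        rw [Nat.card_sigma]
        push_cast
        rfl
    _ ≤ ∑ _j : I, Real.exp (C * ((p : ℝ) ^ (1 - β) * (T : ℝ) ^ β)) :=
        Finset.sum_le_sum fun j _ => hZcard j
    _ = Nat.card I * Real.exp (C * ((p : ℝ) ^ (1 - β) * (T : ℝ) ^ β)) := by
        simp [Nat.card_eq_fintype_card]
    _ ≤ _ := by gcongr

/-- The upper bound for the exponent attached to any contraction coefficient `η > y`. -/
theorem ncard_contractingBall_le_exp {p : ℕ} [Fact p.Prime] {D : Type} [AddCommGroup D]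
    [Finite D] {c : ℕ → D →+ ZMod p} {R : ℕ}
    (hR : ∀ i d, ∃ k < R, c (i + k) d = 0) (hR2 : 3 ≤ R)
    {y : ℝ} (hy0 : 0 < y) (hy : 2 ≤ y ^ R + y ^ (R - 1) + y ^ (R - 2))
    {η : ℝ} (hyη : y < η) (hη : η < 1) :
    ∃ C : ℝ, 0 < C ∧ ∀ n i : ℕ, ((contractingBall c R y i n).ncard : ℝ) ≤
      Real.exp (C * (n : ℝ) ^ (Real.log p / (Real.log p - Real.log η))) := by
  have hy1 : y < 1 := hyη.trans hη
  have hp2 : 2 ≤ p := (Fact.out : p.Prime).two_le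
  have hp0 : (0 : ℝ) < p := by exact_mod_cast (by omega : 0 < p)
  have hlogp : 0 < Real.log p := Real.log_pos (by exact_mod_cast hp2)
  have hη0 : 0 < η := hy0.trans hyη
  have hlogη : Real.log η < 0 := Real.log_neg hη0 hη
  set β := Real.log p / (Real.log p - Real.log η) with hβ
  have hβ0 : 0 < β := div_pos hlogp (by linarith)
  have hβ1 : β ≤ 1 := (div_le_one (by linarith)).mpr (by linarith)
  -- The exponent `β` is the solution of this equation, the break-even point of the recursion with
  -- contraction `η`.
  have hcrit : (p : ℝ) ^ (1 - β) * η ^ β = 1 := by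
    rw [Real.rpow_def_of_pos hp0, Real.rpow_def_of_pos hη0, ← Real.exp_add, Real.exp_eq_one_iff]
    have h1 : Real.log p - Real.log η ≠ 0 := by linarith
    rw [hβ]
    field_simp
    ring
  -- The gap `y < z` absorbs the additive errors in the radius, and `z < η` gives `θ < 1`, which
  -- absorbs the polynomial factor `p * n ^ p`.
  obtain ⟨z, hyz, hzη⟩ := exists_between hyη
  have hz0 : 0 < z := hy0.trans hyz
  set θ := (p : ℝ) ^ (1 - β) * z ^ β with hθ
  have hθ1 : θ < 1 := by
    rw [← hcrit]
    exact mul_lt_mul_of_pos_left (Real.rpow_lt_rpow hz0.le hzη hβ0) (Real.rpow_pos_of_pos hp0 _)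
  have hev1 : ∀ᶠ n : ℕ in Filter.atTop, y * ((n : ℝ) + 1) + p + 1 ≤ z * n := by
    obtain ⟨N, hN⟩ := exists_nat_ge ((y + p + 1) / (z - y))
    filter_upwards [Filter.eventually_ge_atTop N] with n hn
    rw [div_le_iff₀ (by linarith)] at hN
    have : (N : ℝ) * (z - y) ≤ n * (z - y) :=
      mul_le_mul_of_nonneg_right (by exact_mod_cast hn) (by linarith)
    linarith
  have hev2 : ∀ᶠ n : ℕ in Filter.atTop,
      Real.log p + p * Real.log n ≤ (1 - θ) * (n : ℝ) ^ β := by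
    have h1 : (fun x : ℝ => Real.log p + p * Real.log x) =o[Filter.atTop] fun x => x ^ β := by
      refine Asymptotics.IsLittleO.add ?_ ((isLittleO_log_rpow_atTop hβ0).const_mul_left _)
      exact Asymptotics.isLittleO_const_left.mpr (Or.inr (by
        simpa using (tendsto_rpow_atTop hβ0).congr' (by
          filter_upwards [Filter.eventually_ge_atTop (0 : ℝ)] with x hx
          simp [abs_of_nonneg (Real.rpow_nonneg hx β)])))
    have h2 := (h1.comp_tendsto tendsto_natCast_atTop_atTop).def (sub_pos.mpr hθ1)
    filter_upwards [h2] with n hn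
    simp only [Function.comp_apply, Real.norm_eq_abs] at hn
    rw [abs_of_nonneg (a := (n : ℝ) ^ β) (by positivity)] at hn
    exact (le_abs_self _).trans hn
  obtain ⟨n₀, hn₀⟩ := Filter.eventually_atTop.mp (hev1.and hev2)
  obtain ⟨Q, hQ⟩ := exists_ncard_contractingBall_le hR hR2 hy0 hy1 hy (n₀ : ℝ)
  -- `Real.log Q` handles the radii below `n₀`; `C ≥ 1` lets `C * (1 - θ) * n ^ β` dominate the
  -- logarithmic terms in the induction step.
  refine ⟨max 1 (Real.log Q), lt_max_of_lt_left one_pos, ?_⟩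
  set C := max 1 (Real.log Q)
  have hC1 : 1 ≤ C := le_max_left _ _
  intro n
  induction n using Nat.strong_induction_on with
  | _ n ih =>
  intro i
  rcases Nat.eq_zero_or_pos n with rfl | hn
  · have := contractingBall_zero c hR2 hy0 hy1 hy i
    simp [this, Real.zero_rpow hβ0.ne']
  have hn1 : (1 : ℝ) ≤ n := by exact_mod_cast hn
  rcases lt_or_ge n n₀ with h | h
  · have h1 : ((contractingBall c R y i n).ncard : ℝ) ≤ Q := by
      have := Set.ncard_le_ncard (weightBall_mono c i (Sum.elim (spinWeight c R y i)
        fun _ => 1 - y ^ R) (show (n : ℝ) ≤ n₀ by exact_mod_cast h.le))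
        (finite_contractingBall hR hR2 hy0 hy1 hy i n₀)
      exact_mod_cast this.trans (hQ i)
    have h2 : 1 ≤ (contractingBall c R y i n).ncard :=
      (Set.ncard_pos (finite_contractingBall hR hR2 hy0 hy1 hy i n)).mpr
        ⟨1, one_mem_weightBall c i _ (by positivity)⟩
    have hQ0 : (0 : ℝ) < Q := lt_of_lt_of_le (by exact_mod_cast h2) h1
    refine h1.trans ?_
    rw [← Real.log_le_iff_le_exp hQ0]
    calc Real.log Q ≤ C * 1 := by rw [mul_one]; exact le_max_right _ _
      _ ≤ C * (n : ℝ) ^ β := by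
        gcongr
        exact Real.one_le_rpow hn1 hβ0.le
  · obtain ⟨hA, hB⟩ := hn₀ n h
    have hzn : 0 ≤ z * n := by positivity
    set T := ⌊z * n⌋₊ with hT
    have hTle : (T : ℝ) ≤ z * n := Nat.floor_le hzn
    have hTn : T < n := by
      have : (T : ℝ) < n := hTle.trans_lt (by nlinarith)
      exact_mod_cast this
    have hTge : y * ((n : ℝ) + 1) + p ≤ T := by
      have := Nat.lt_floor_add_one (z * n)
      rw [← hT] at this
      linarith
    refine (ncard_contractingBall_step hR hR2 hy0 hy1 hy hTge hβ0 hβ1 (by linarith)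
      (fun m hm => ih m (by omega) (i + 1))).trans ?_
    have h1 : ((T : ℝ) + 1) ≤ n := by exact_mod_cast hTn
    have h2 : (p : ℝ) ^ (1 - β) * (T : ℝ) ^ β ≤ θ * (n : ℝ) ^ β := by
      rw [hθ, mul_assoc, ← Real.mul_rpow hz0.le (by positivity)]
      gcongr
    have h3 : (0 : ℝ) ≤ (n : ℝ) ^ β := by positivity
    calc (p : ℝ) * (T + 1) ^ p * Real.exp (C * ((p : ℝ) ^ (1 - β) * (T : ℝ) ^ β))
        ≤ p * (n : ℝ) ^ p * Real.exp (C * (θ * (n : ℝ) ^ β)) := by gcongr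
      _ = Real.exp (Real.log p + p * Real.log n + C * (θ * (n : ℝ) ^ β)) := by
          rw [Real.exp_add, Real.exp_add, Real.exp_log hp0, mul_comm (p : ℝ) (Real.log n),
            ← Real.rpow_def_of_pos (by linarith), Real.rpow_natCast]
      _ ≤ Real.exp (C * (n : ℝ) ^ β) := by
          apply Real.exp_le_exp.mpr
          have h4 : (1 - θ) * (n : ℝ) ^ β ≤ C * ((1 - θ) * (n : ℝ) ^ β) :=
            le_mul_of_one_le_left (mul_nonneg (by linarith) h3) hC1
          linarith

/-! ### Sushchansky groups -/

/-- The homomorphism `(a, b) ↦ a uᵢ + b vᵢ`. -/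
def coeff {p : ℕ} [Fact p.Prime] (lam : ZMod (p ^ 2) ≃ ZMod p × ZMod p) (i : ℕ) :
    ZMod p × ZMod p →+ ZMod p where
  toFun d := d.1 * wordU lam i + d.2 * wordV lam i
  map_zero' := by simp
  map_add' d e := by simp; ring

theorem coeff_apply {p : ℕ} [Fact p.Prime] (lam : ZMod (p ^ 2) ≃ ZMod p × ZMod p) (i : ℕ)
    (d : ZMod p × ZMod p) : coeff lam i d = d.1 * wordU lam i + d.2 * wordV lam i := rfl

theorem coeff_surjective {p : ℕ} [Fact p.Prime] (lam : ZMod (p ^ 2) ≃ ZMod p × ZMod p) (i : ℕ) :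
    Function.Surjective (coeff lam i) := by
  intro a
  by_cases h : (lam i).2 = 0
  · exact ⟨(0, a), by simp [coeff_apply, wordU, wordV, h]⟩
  · exact ⟨(a, 0), by simp [coeff_apply, wordU, h]⟩

theorem coeff_eq_zero {p : ℕ} [Fact p.Prime] (lam : ZMod (p ^ 2) ≃ ZMod p × ZMod p) (i : ℕ) :
    coeff lam i (lam i) = 0 := by
  by_cases h : (lam i).2 = 0
  · simp [coeff_apply, wordU, h]
  · simp only [coeff_apply, wordU, wordV, h, if_false]
    field_simp
    ring

theorem exists_index_cast_eq {N : ℕ} [NeZero N] (i : ℕ) (s : ZMod N) :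
    ((i + (s - i).val : ℕ) : ZMod N) = s := by
  simp

/-- The form at the index of `d` kills `d`; the form at the index of `d + d` kills `d + d`, hence
`d`, since `2` is invertible. For `d ≠ 0` these are different residues modulo `p ^ 2`, so at most
one of them has the last offset `p ^ 2 - 1` in the window. -/
theorem exists_coeff_eq_zero {p : ℕ} [Fact p.Prime] (hp : 2 < p)
    (lam : ZMod (p ^ 2) ≃ ZMod p × ZMod p) (i : ℕ) (d : ZMod p × ZMod p) :
    ∃ k < p ^ 2 - 1, coeff lam (i + k) d = 0 := by
  have hN : 9 ≤ p ^ 2 := by nlinarith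
  have : NeZero (p ^ 2) := ⟨by omega⟩
  have hp2 : Fact (2 < p) := ⟨hp⟩
  have h2 : (2 : ZMod p) ≠ 0 := by
    have := ZMod.neg_one_ne_one (n := p)
    intro h
    apply this
    rw [neg_eq_iff_add_eq_zero, one_add_one_eq_two, h]
  have hdouble : ∀ a : ZMod p, a + a = 0 → a = 0 := fun a ha => by
    rw [← two_mul] at ha
    exact (mul_eq_zero.mp ha).resolve_left h2
  by_cases hd : d = 0
  · exact ⟨0, by omega, by rw [hd, map_zero]⟩
  have hne : lam.symm d ≠ lam.symm (d + d) := fun h => hd (by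
    simpa using lam.symm.injective h)
  have key : ∀ e, coeff lam (i + (lam.symm e - (i : ZMod (p ^ 2))).val) e = 0 := by
    intro e
    have h := coeff_eq_zero lam (i + (lam.symm e - (i : ZMod (p ^ 2))).val)
    rwa [exists_index_cast_eq, Equiv.apply_symm_apply] at h
  have hval : (lam.symm d - (i : ZMod (p ^ 2))).val ≠ (lam.symm (d + d) - (i : ZMod (p ^ 2))).val := fun h =>
    hne (sub_left_injective (ZMod.val_injective _ h))
  have hl1 := ZMod.val_lt (lam.symm d - (i : ZMod (p ^ 2)))
  have hl2 := ZMod.val_lt (lam.symm (d + d) - (i : ZMod (p ^ 2)))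
  by_cases h : (lam.symm d - (i : ZMod (p ^ 2))).val < p ^ 2 - 1
  · exact ⟨_, h, key d⟩
  · refine ⟨(lam.symm (d + d) - (i : ZMod (p ^ 2))).val, by omega, ?_⟩
    have := key (d + d)
    rw [map_add] at this
    exact hdouble _ this

theorem coeff_add_period {p : ℕ} [Fact p.Prime] (lam : ZMod (p ^ 2) ≃ ZMod p × ZMod p) (i : ℕ) :
    coeff lam (i + p ^ 2) = coeff lam i := by
  ext
  all_goals simp [coeff_apply, wordU, wordV]

theorem spin_congr {p : ℕ} {D : Type} [AddCommGroup D] (c : ℕ → D →+ ZMod p) {i j : ℕ}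
    (h : ∀ k, c (i + k) = c (j + k)) (d : D) : spin c i d = spin c j d := by
  ext1 w
  induction w generalizing i j with
  | nil => rfl
  | cons x w ih =>
    have h0 := h 0
    rw [add_zero, add_zero] at h0
    have h1 : spin c (i + 1) d w = spin c (j + 1) d w := ih fun k => by
      have := h (1 + k)
      rwa [← add_assoc, ← add_assoc] at this
    rw [spin_eq c i, spin_eq c j, wreath_cons, wreath_cons, h0]
    by_cases hx : x = 0
    · simp [hx, h1]
    · simp [hx]

theorem spinBall_period {p : ℕ} [Fact p.Prime] (lam : ZMod (p ^ 2) ≃ ZMod p × ZMod p) (i k : ℕ) :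
    spinBall (coeff lam) (i + p ^ 2) k = spinBall (coeff lam) i k := by
  have : syllable (coeff lam) (i + p ^ 2) = syllable (coeff lam) i := by
    have : spin (coeff lam) (i + p ^ 2) = spin (coeff lam) i := funext fun d =>
      spin_congr _ (fun k => by rw [add_right_comm, coeff_add_period]) d
    rw [syllable, syllable, this]
  rw [spinBall, weightBall, this]
  rfl

theorem treeAut_qPortrait {p : ℕ} [Fact p.Prime] (lam : ZMod (p ^ 2) ≃ ZMod p × ZMod p) (i : ℕ) :
    treeAut (qPortrait lam i) = spin (coeff lam) i (1, 0) := by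
  simp [qPortrait, spin, coeff_apply]

theorem treeAut_rPortrait {p : ℕ} [Fact p.Prime] (lam : ZMod (p ^ 2) ≃ ZMod p × ZMod p) (i : ℕ) :
    treeAut (rPortrait lam i) = spin (coeff lam) i (0, 1) := by
  simp [rPortrait, spin, coeff_apply]

/-! ### Balls of `H` in terms of syllables -/

/-- The generators of `H`. -/
def gensH {p : ℕ} [Fact p.Prime] (lam : ZMod (p ^ 2) ≃ ZMod p × ZMod p) :
    Set (Equiv.Perm (List (ZMod p))) :=
  {treeAut (qPortrait lam 1), treeAut (rPortrait lam 1), sigmaAut p}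

/-- The generators of `G_λ`. -/
def gensG {p : ℕ} [Fact p.Prime] (lam : ZMod (p ^ 2) ≃ ZMod p × ZMod p) :
    Set (Equiv.Perm (List (ZMod p))) :=
  {treeAut (portraitA p), treeAut (portraitB lam)}

theorem finite_gensH {p : ℕ} [Fact p.Prime] (lam : ZMod (p ^ 2) ≃ ZMod p × ZMod p) :
    (gensH lam).Finite := by simp [gensH]

theorem finite_gensG {p : ℕ} [Fact p.Prime] (lam : ZMod (p ^ 2) ≃ ZMod p × ZMod p) :
    (gensG lam).Finite := by simp [gensG]

theorem rot_nsmul {p : ℕ} (n : ℕ) (a : ZMod p) : rot (n • a) = rot a ^ n := by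
  induction n with
  | zero => simp [rot_zero]
  | succ n ih => rw [succ_nsmul, rot_add, ih, pow_succ]

theorem spin_nsmul {p : ℕ} {D : Type} [AddCommGroup D] (c : ℕ → D →+ ZMod p) (i n : ℕ) (d : D) :
    spin c i (n • d) = spin c i d ^ n := by
  induction n with
  | zero => simp [spin_zero]
  | succ n ih => rw [succ_nsmul, spin_add, ih, pow_succ]

theorem rot_mem_groupH {p : ℕ} [Fact p.Prime] (lam : ZMod (p ^ 2) ≃ ZMod p × ZMod p)
    (a : ZMod p) : rot a ∈ groupH lam := by
  have h : a = a.val • (1 : ZMod p) := by simp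
  rw [h, rot_nsmul]
  exact Subgroup.pow_mem (groupH lam) (Subgroup.subset_closure (Or.inr (Or.inr rfl))) _

theorem spin_mem_groupH {p : ℕ} [Fact p.Prime] (lam : ZMod (p ^ 2) ≃ ZMod p × ZMod p)
    (d : ZMod p × ZMod p) : spin (coeff lam) 1 d ∈ groupH lam := by
  have h : d = d.1.val • ((1, 0) : ZMod p × ZMod p) + d.2.val • ((0, 1) : ZMod p × ZMod p) := by
    ext <;> simp
  rw [h, spin_add, spin_nsmul, spin_nsmul]
  rw [← treeAut_qPortrait, ← treeAut_rPortrait]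
  exact (groupH lam).mul_mem
    ((groupH lam).pow_mem (Subgroup.subset_closure (Or.inl rfl)) _)
    ((groupH lam).pow_mem (Subgroup.subset_closure (Or.inr (Or.inl rfl))) _)

theorem exists_syllable_of_mem_gensH {p : ℕ} [Fact p.Prime]
    (lam : ZMod (p ^ 2) ≃ ZMod p × ZMod p) {s : Equiv.Perm (List (ZMod p))}
    (hs : s ∈ gensH lam ∨ s⁻¹ ∈ gensH lam) : ∃ t, s = syllable (coeff lam) 1 t := by
  have key : ∀ s ∈ gensH lam, (∃ d, s = spin (coeff lam) 1 d) ∨ ∃ a, s = rot a := by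
    rintro s (rfl | rfl | rfl)
    · exact Or.inl ⟨_, treeAut_qPortrait lam 1⟩
    · exact Or.inl ⟨_, treeAut_rPortrait lam 1⟩
    · exact Or.inr ⟨1, rfl⟩
  rcases hs with hs | hs
  · rcases key s hs with ⟨d, rfl⟩ | ⟨a, rfl⟩
    · exact ⟨Sum.inl d, rfl⟩
    · exact ⟨Sum.inr a, rfl⟩
  · rcases key _ hs with ⟨d, h⟩ | ⟨a, h⟩
    · exact ⟨Sum.inl (-d), by rw [syllable_inl, spin_neg, ← h, inv_inv]⟩
    · exact ⟨Sum.inr (-a), by rw [syllable_inr, rot_neg, ← h, inv_inv]⟩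

theorem wordBall_gensH_subset {p : ℕ} [Fact p.Prime] (lam : ZMod (p ^ 2) ≃ ZMod p × ZMod p)
    {τ : (ZMod p × ZMod p) ⊕ ZMod p → ℝ} (hτ : ∀ s, τ s ≤ 1) (n : ℕ) :
    wordBall (gensH lam) n ⊆ weightBall (coeff lam) 1 τ n := by
  intro g hg
  refine wordBall_induction (P := fun n g => g ∈ weightBall (coeff lam) 1 τ n)
    (fun n => one_mem_weightBall _ _ _ (by positivity)) (fun n s g hs hg => ?_) hg
  obtain ⟨t, rfl⟩ := exists_syllable_of_mem_gensH lam hs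
  have := weightBall_mul (coeff lam) 1 (syllable_mem_weightBall (coeff lam) 1 t (hτ t)) hg
  rwa [add_comm, ← Nat.cast_succ] at this

theorem wordBall_gensH_subset_spinBall {p : ℕ} [Fact p.Prime]
    (lam : ZMod (p ^ 2) ≃ ZMod p × ZMod p) (n : ℕ) :
    wordBall (gensH lam) n ⊆ spinBall (coeff lam) 1 n :=
  wordBall_gensH_subset lam (by rintro (d | a) <;> simp) n

/-- Rotations are free in `spinBall`, but after merging there are at most `k` pairs and a leading
rotation, hence at most `2k + 1` syllables from a finite set. -/
theorem exists_spinBall_subset_wordBall {p : ℕ} [Fact p.Prime]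
    (lam : ZMod (p ^ 2) ≃ ZMod p × ZMod p) :
    ∃ C : ℕ, ∀ k, spinBall (coeff lam) 1 k ⊆ wordBall (gensH lam) (C * (2 * k + 1)) := by
  set T : Set (Equiv.Perm (List (ZMod p))) := Set.range (syllable (coeff lam) 1)
  obtain ⟨C, hC⟩ := exists_wordBall_subset (S := gensH lam) (T := T) (Set.finite_range _) (by
    rintro g ⟨d | a, rfl⟩
    · exact spin_mem_groupH lam d
    · exact rot_mem_groupH lam a)
  refine ⟨C, fun k => Set.Subset.trans ?_ (hC _)⟩
  rintro g ⟨L, hL, rfl⟩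
  obtain ⟨a, M, h1, hM⟩ := exists_altProd (coeff lam) 1 le_rfl (τ := fun _ => 1)
    (fun _ => zero_le_one) (fun _ _ => by norm_num) L
  have hk : M.length ≤ k := by
    have := hM.trans (add_le_add_left hL 0)
    simp only [zero_add, List.map_const', List.sum_replicate, add_zero, nsmul_eq_mul,
      mul_one] at this
    exact_mod_cast this
  have hrot : ∀ a, rot a ∈ wordBall T 1 := fun a => mem_wordBall_one ⟨Sum.inr a, rfl⟩
  have hspin : ∀ d, spin (coeff lam) 1 d ∈ wordBall T 1 := fun d =>
    mem_wordBall_one ⟨Sum.inl d, rfl⟩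
  have halt : altProd (coeff lam) 1 M ∈ wordBall T (2 * M.length) := by
    clear hM h1 hk
    induction M with
    | nil => exact one_mem_wordBall _ _
    | cons m M ih =>
      rw [altProd_cons]
      have := wordBall_mul (wordBall_mul (hspin m.1) (hrot m.2)) ih
      rwa [show 1 + 1 + 2 * M.length = 2 * (m :: M).length by simp; ring] at this
  rw [h1]
  exact wordBall_mono T (by omega) (wordBall_mul (hrot a) halt)

/-- Powers of the growth function of `H` are dominated by the growth function. -/
theorem exists_ncard_wordBall_gensH_pow_le {p : ℕ} [Fact p.Prime] (hp : 2 < p)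
    (lam : ZMod (p ^ 2) ≃ ZMod p × ZMod p) (M : ℕ) :
    ∃ C : ℕ, ∀ n, 1 ≤ n → M * (wordBall (gensH lam) n).ncard ^ p ^ 2 ≤
      (wordBall (gensH lam) (C * n)).ncard := by
  have hc := coeff_surjective lam
  obtain ⟨k₀, hk₀1, hk₀⟩ := exists_le_ncard_spinBall hp (coeff lam) hc (M + 1)
  obtain ⟨k₁, C₁, h₁⟩ := exists_ncard_spinBall_pow_le hp (coeff lam) hc (p ^ 2)
  obtain ⟨C₂, h₂⟩ := exists_spinBall_subset_wordBall lam
  refine ⟨C₂ * (2 * (C₁ * (k₀ + k₁)) + 1), fun n hn => ?_⟩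
  set N := (spinBall (coeff lam) 1 ((k₀ + k₁) * n)).ncard
  have hkn : k₀ + k₁ ≤ (k₀ + k₁) * n := Nat.le_mul_of_pos_right _ hn
  have hN1 : M + 1 ≤ N := hk₀ _ (by omega) 1
  have hN2 : (wordBall (gensH lam) n).ncard ≤ N :=
    Set.ncard_le_ncard ((wordBall_gensH_subset_spinBall lam n).trans
      (spinBall_mono _ _ (Nat.le_mul_of_pos_left n (by omega)))) (finite_spinBall _ _ _)
  calc M * (wordBall (gensH lam) n).ncard ^ p ^ 2 ≤ N * N ^ p ^ 2 :=
        Nat.mul_le_mul (by omega) (Nat.pow_le_pow_left hN2 _)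
    _ = N ^ (p ^ 2 + 1) := by ring
    -- Squaring `p ^ 2` times more than suffices, and it shifts the index by exactly one period, so
    -- the same balls return.
    _ ≤ N ^ 2 ^ p ^ 2 := Nat.pow_le_pow_right (by omega) Nat.lt_two_pow_self
    _ ≤ (spinBall (coeff lam) 1 (C₁ * ((k₀ + k₁) * n))).ncard := by
        have := h₁ ((k₀ + k₁) * n) (by omega) 1
        rwa [spinBall_period] at this
    _ ≤ (wordBall (gensH lam) (C₂ * (2 * (C₁ * ((k₀ + k₁) * n)) + 1))).ncard :=
        Set.ncard_le_ncard (h₂ _) (finite_wordBall (finite_gensH lam) _)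
    _ ≤ _ := by
        apply ncard_wordBall_mono (finite_gensH lam)
        rw [mul_assoc C₂]
        apply Nat.mul_le_mul_left
        calc 2 * (C₁ * ((k₀ + k₁) * n)) + 1 ≤ 2 * (C₁ * ((k₀ + k₁) * n)) + n :=
              Nat.add_le_add_left hn _
          _ = _ := by ring

/-! ### Comparison of `G_λ` and `H` -/

theorem treeAut_portraitA_eq (p : ℕ) : treeAut (portraitA p) =
    wreath (fun x => wreath (fun _ => 1) (sigmaPow x)) (sigmaPow 1) := by
  rw [treeAut_eq_wreath]
  congr 1
  funext x
  rw [treeAut_eq_wreath]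
  congr 1
  funext y
  exact treeAut_one

theorem treeAut_portraitB_eq {p : ℕ} [Fact p.Prime] (lam : ZMod (p ^ 2) ≃ ZMod p × ZMod p) :
    treeAut (portraitB lam) = wreath (fun x => wreath (fun y =>
      if x = 0 ∧ y = 0 then treeAut (qPortrait lam 1)
      else if x = 1 ∧ y = 0 then treeAut (rPortrait lam 1)
      else if x = 2 ∧ y = 1 then sigmaAut p else 1) 1) 1 := by
  rw [treeAut_eq_wreath]
  congr 1
  funext x
  rw [treeAut_eq_wreath]
  congr 1
  funext y
  simp only [portraitB]
  split_ifs
  · rfl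
  · rfl
  · rfl
  · exact treeAut_one

/-- Every second level section of `A` or `B_λ` is trivial or a generator of `H`, so a word of length
`n` has second level sections of length at most `n`. -/
theorem wordBall_gensG_decompose {p : ℕ} [Fact p.Prime] (lam : ZMod (p ^ 2) ≃ ZMod p × ZMod p)
    {n : ℕ} {g : Equiv.Perm (List (ZMod p))} (hg : g ∈ wordBall (gensG lam) n) :
    ∃ (π : Equiv.Perm (ZMod p)) (ρ : ZMod p → Equiv.Perm (ZMod p))
      (h : ZMod p → ZMod p → Equiv.Perm (List (ZMod p))),
      (∀ x y, h x y ∈ wordBall (gensH lam) n) ∧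
        g = wreath (fun x => wreath (h x) (ρ x)) π := by
  have hgen : ∀ s ∈ gensG lam, ∃ (π : Equiv.Perm (ZMod p)) (ρ : ZMod p → Equiv.Perm (ZMod p))
      (h : ZMod p → ZMod p → Equiv.Perm (List (ZMod p))),
      (∀ x y, h x y ∈ wordBall (gensH lam) 1) ∧ s = wreath (fun x => wreath (h x) (ρ x)) π := by
    rintro s (rfl | rfl)
    · exact ⟨_, _, _, fun _ _ => one_mem_wordBall _ 1, treeAut_portraitA_eq p⟩
    · refine ⟨_, _, _, fun x y => ?_, treeAut_portraitB_eq lam⟩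
      split_ifs
      · exact mem_wordBall_one (Or.inl rfl)
      · exact mem_wordBall_one (Or.inr (Or.inl rfl))
      · exact mem_wordBall_one (Or.inr (Or.inr rfl))
      · exact one_mem_wordBall _ 1
  refine wordBall_induction (P := fun n g => ∃ (π : Equiv.Perm (ZMod p))
    (ρ : ZMod p → Equiv.Perm (ZMod p)) (h : ZMod p → ZMod p → Equiv.Perm (List (ZMod p))),
    (∀ x y, h x y ∈ wordBall (gensH lam) n) ∧ g = wreath (fun x => wreath (h x) (ρ x)) π)
    (fun n => ⟨1, fun _ => 1, fun _ _ => 1, fun _ _ => one_mem_wordBall _ n, by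
      simp only [wreath_one]⟩) (fun n s g hs hg => ?_) hg
  obtain ⟨π, ρ, h, h1, rfl⟩ := hg
  have hs' : ∃ (π : Equiv.Perm (ZMod p)) (ρ : ZMod p → Equiv.Perm (ZMod p))
      (h : ZMod p → ZMod p → Equiv.Perm (List (ZMod p))),
      (∀ x y, h x y ∈ wordBall (gensH lam) 1) ∧ s = wreath (fun x => wreath (h x) (ρ x)) π := by
    rcases hs with hs | hs
    · exact hgen s hs
    · obtain ⟨π, ρ, h, h1, h2⟩ := hgen _ hs
      refine ⟨π⁻¹, fun x => (ρ (π⁻¹ x))⁻¹,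
        fun x y => (h (π⁻¹ x) ((ρ (π⁻¹ x))⁻¹ y))⁻¹, fun x y => wordBall_inv (h1 _ _), ?_⟩
      rw [← inv_inv s, h2, wreath_inv]
      simp only [wreath_inv]
  obtain ⟨π', ρ', h', h1', rfl⟩ := hs'
  refine ⟨π' * π, fun x => ρ' (π x) * ρ x, fun x y => h' (π x) (ρ x y) * h x y, fun x y => ?_, ?_⟩
  · rw [add_comm]
    exact wordBall_mul (h1' _ _) (h1 _ _)
  · simp only [wreath_mul]

theorem ncard_wordBall_gensG_le {p : ℕ} [Fact p.Prime] (lam : ZMod (p ^ 2) ≃ ZMod p × ZMod p) :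
    ∃ M : ℕ, ∀ n, (wordBall (gensG lam) n).ncard ≤
      M * (wordBall (gensH lam) n).ncard ^ p ^ 2 := by
  refine ⟨Nat.card (Equiv.Perm (ZMod p) × (ZMod p → Equiv.Perm (ZMod p))), fun n => ?_⟩
  have : Finite (wordBall (gensH lam) n) := finite_wordBall (finite_gensH lam) n
  let F : (Equiv.Perm (ZMod p) × (ZMod p → Equiv.Perm (ZMod p))) ×
      (ZMod p → ZMod p → wordBall (gensH lam) n) → Equiv.Perm (List (ZMod p)) := fun q =>
    wreath (fun x => wreath (fun y => (q.2 x y : Equiv.Perm (List (ZMod p)))) (q.1.2 x)) q.1.1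
  have hsub : wordBall (gensG lam) n ⊆ Set.range F := by
    intro g hg
    obtain ⟨π, ρ, h, h1, rfl⟩ := wordBall_gensG_decompose lam hg
    exact ⟨((π, ρ), fun x y => ⟨h x y, h1 x y⟩), rfl⟩
  refine (Set.ncard_le_ncard hsub (Set.finite_range F)).trans ?_
  rw [← Nat.card_coe_set_eq]
  refine (Finite.card_range_le F).trans (le_of_eq ?_)
  rw [Nat.card_prod, Nat.card_fun, Nat.card_fun, Nat.card_zmod, Nat.card_coe_set_eq, ← pow_mul,
    ← pow_two]

theorem portraitA_apply {p : ℕ} (x y : ZMod p) (w : List (ZMod p)) :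
    treeAut (portraitA p) (x :: y :: w) = (x + 1) :: (y + x) :: w := by
  rw [treeAut_portraitA_eq]
  simp [sigmaPow_apply]

/-- Every element of `H` is the section at `00` of an element of `G_λ` of comparable length that
fixes `00`. -/
theorem exists_section_eq {p : ℕ} [Fact p.Prime]
    (lam : ZMod (p ^ 2) ≃ ZMod p × ZMod p) {n : ℕ} {h : Equiv.Perm (List (ZMod p))}
    (hh : h ∈ wordBall (gensH lam) n) :
    ∃ g ∈ wordBall (gensG lam) (5 * n), ∀ w, g (0 :: 0 :: w) = 0 :: 0 :: h w := by
  have hA : treeAut (portraitA p) ∈ wordBall (gensG lam) 1 := mem_wordBall_one (Or.inl rfl)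
  have hB : treeAut (portraitB lam) ∈ wordBall (gensG lam) 1 := mem_wordBall_one (Or.inr rfl)
  have hA' := wordBall_inv hA
  have hA00 : ∀ w, treeAut (portraitA p) (0 :: 0 :: w) = 1 :: 0 :: w := fun w => by
    rw [portraitA_apply]; simp
  have hA10 : ∀ w, treeAut (portraitA p) (1 :: 0 :: w) = 2 :: 1 :: w := fun w => by
    rw [portraitA_apply, one_add_one_eq_two, zero_add]
  have hA00' : ∀ w, (treeAut (portraitA p))⁻¹ (1 :: 0 :: w) = 0 :: 0 :: w := fun w => by
    rw [Equiv.Perm.inv_eq_iff_eq, hA00]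
  have hA10' : ∀ w, (treeAut (portraitA p))⁻¹ (2 :: 1 :: w) = 1 :: 0 :: w := fun w => by
    rw [Equiv.Perm.inv_eq_iff_eq, hA10]
  have hgen : ∀ s ∈ gensH lam, ∃ g ∈ wordBall (gensG lam) 5,
      ∀ w, g (0 :: 0 :: w) = 0 :: 0 :: s w := by
    -- `A` maps the prefix `00` to `10` and `10` to `21`. Hence `B_λ`, `A⁻¹ B_λ A` and `A⁻² B_λ A²`
    -- fix `00` with sections `q₁`, `r₁` and `σ` there; the longest of these words has length `5`.
    rintro s (rfl | rfl | rfl)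
    · refine ⟨treeAut (portraitB lam), wordBall_mono _ (by norm_num) hB, fun w => ?_⟩
      rw [treeAut_portraitB_eq]
      simp
    · refine ⟨(treeAut (portraitA p))⁻¹ * treeAut (portraitB lam) * treeAut (portraitA p),
        wordBall_mono _ (by norm_num) (wordBall_mul (wordBall_mul hA' hB) hA), fun w => ?_⟩
      rw [Equiv.Perm.mul_apply, Equiv.Perm.mul_apply, hA00, ← hA00']
      congr 1
      rw [treeAut_portraitB_eq]
      simp
    · refine ⟨(treeAut (portraitA p))⁻¹ * ((treeAut (portraitA p))⁻¹ * treeAut (portraitB lam) *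
        treeAut (portraitA p)) * treeAut (portraitA p),
        wordBall_mono _ (by norm_num) (wordBall_mul (wordBall_mul hA' (wordBall_mul
          (wordBall_mul hA' hB) hA)) hA), fun w => ?_⟩
      simp only [Equiv.Perm.mul_apply]
      rw [hA00, hA10, ← hA00', ← hA10']
      congr 2
      rw [treeAut_portraitB_eq]
      simp
  refine wordBall_induction (P := fun n h => ∃ g ∈ wordBall (gensG lam) (5 * n),
    ∀ w, g (0 :: 0 :: w) = 0 :: 0 :: h w) (fun n => ⟨1, one_mem_wordBall _ _, fun _ => rfl⟩)
    (fun n s h hs hh => ?_) hh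
  obtain ⟨g, hg, hgw⟩ := hh
  have hs' : ∃ g ∈ wordBall (gensG lam) 5, ∀ w, g (0 :: 0 :: w) = 0 :: 0 :: s w := by
    rcases hs with hs | hs
    · exact hgen s hs
    · obtain ⟨f, hf, hfw⟩ := hgen _ hs
      refine ⟨f⁻¹, wordBall_inv hf, fun w => ?_⟩
      rw [Equiv.Perm.inv_eq_iff_eq, hfw]
      simp
  obtain ⟨f, hf, hfw⟩ := hs'
  refine ⟨f * g, ?_, fun w => by rw [Equiv.Perm.mul_apply, hgw, hfw, Equiv.Perm.mul_apply]⟩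
  rw [mul_add, mul_one, add_comm]
  exact wordBall_mul hf hg

theorem ncard_wordBall_gensH_le {p : ℕ} [Fact p.Prime]
    (lam : ZMod (p ^ 2) ≃ ZMod p × ZMod p) (n : ℕ) :
    (wordBall (gensH lam) n).ncard ≤ (wordBall (gensG lam) (5 * n)).ncard := by
  choose! g hg hgw using fun h (hh : h ∈ wordBall (gensH lam) n) => exists_section_eq lam hh
  refine Set.ncard_le_ncard_of_injOn g hg (fun h hh h' hh' heq => ?_)
    (finite_wordBall (finite_gensG lam) _)
  ext1 w
  have := hgw h hh w
  rw [heq, hgw h' hh' w] at this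
  simpa using this.symm

/-- `H` is a `𝖦` group. -/
theorem isGGroup_groupH {p : ℕ} [Fact p.Prime] (lam : ZMod (p ^ 2) ≃ ZMod p × ZMod p) :
    IsGGroup (groupH lam) := by
  have hN : p ^ 2 ≠ 0 := pow_ne_zero 2 (Fact.out : p.Prime).ne_zero
  -- By periodicity every pair is `lam i` for infinitely many `i`, so each infinitude claim reduces
  -- to a single pair `e`.
  have hinf : ∀ (P : ℕ → Prop) (e : ZMod p × ZMod p), (∀ i : ℕ, lam i = e → P i) →
      {i | P i}.Infinite := by
    intro P e h
    have : NeZero (p ^ 2) := ⟨hN⟩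
    refine Set.infinite_of_forall_exists_gt fun n => ⟨n + 1 + (lam.symm e - (n + 1 : ℕ)).val,
      h _ ?_, by omega⟩
    rw [exists_index_cast_eq, Equiv.apply_symm_apply]
  have hone : ∀ a : ZMod p, sigmaPow a = 1 ↔ a = 0 := fun a => by
    rw [← sigmaPow_zero, sigmaPow_injective.eq_iff]
  let R : Subgroup (Equiv.Perm (ZMod p)) :=
    { carrier := Set.range sigmaPow
      one_mem' := ⟨0, sigmaPow_zero⟩
      mul_mem' := by
        rintro _ _ ⟨a, rfl⟩ ⟨b, rfl⟩
        exact ⟨a + b, sigmaPow_add a b⟩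
      inv_mem' := by
        rintro _ ⟨a, rfl⟩
        refine ⟨-a, ?_⟩
        rw [eq_inv_iff_mul_eq_one, ← sigmaPow_add, neg_add_cancel, sigmaPow_zero] }
  let w : ℕ → Multiplicative (ZMod p × ZMod p) →* Equiv.Perm (ZMod p) := fun i =>
    { toFun := fun d => sigmaPow (coeff lam i d.toAdd)
      map_one' := by simp [sigmaPow_zero]
      map_mul' := fun d e => by simp [sigmaPow_add] }
  refine ⟨R, Multiplicative (ZMod p × ZMod p), inferInstance, w, ?_, ?_, ?_, ?_, ?_⟩
  · apply le_antisymm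
    · refine (Subgroup.closure_le _).mpr ?_
      rintro g (rfl | rfl | rfl)
      · exact Subgroup.subset_closure (Or.inr ⟨.ofAdd (1, 0), treeAut_qPortrait lam 1⟩)
      · exact Subgroup.subset_closure (Or.inr ⟨.ofAdd (0, 1), treeAut_rPortrait lam 1⟩)
      · exact Subgroup.subset_closure (Or.inl ⟨sigmaPow 1, ⟨1, rfl⟩, rfl⟩)
    · refine (Subgroup.closure_le _).mpr ?_
      rintro g (⟨_, ⟨a, rfl⟩, rfl⟩ | ⟨d, rfl⟩)
      · exact rot_mem_groupH lam a
      · exact spin_mem_groupH lam d.toAdd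
  · exact fun x y => ⟨sigmaPow (y - x), ⟨_, rfl⟩, by simp [sigmaPow_apply]⟩
  · intro i _ x y
    obtain ⟨d, hd⟩ := coeff_surjective lam i (y - x)
    exact ⟨.ofAdd d, by simp [w, hd, sigmaPow_apply]⟩
  · intro d
    refine hinf _ d.toAdd fun i hi => ?_
    have := coeff_eq_zero lam i
    rw [hi] at this
    exact (hone _).mpr this
  · intro d hd
    -- At the pair `(0, 1)` the form is the first coordinate, at `(1, 0)` it is the second; a
    -- nonzero `d` is detected by one of them.
    by_cases h2 : d.toAdd.2 = 0
    · have h1 : d.toAdd.1 ≠ 0 := fun h1 => hd (toAdd_eq_zero.mp (Prod.ext h1 h2))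
      refine hinf _ (0, 1) fun i hi h => h1 ?_
      have := (hone _).mp h
      simpa [coeff_apply, wordU, hi, h2] using this
    · refine hinf _ (1, 0) fun i hi h => h2 ?_
      have := (hone _).mp h
      simpa [coeff_apply, wordU, wordV, hi] using this

/-! ### Growth of finitely generated groups -/

/-- The word balls of `S` are no larger than those of `T`, up to a linear change of the radius. -/
def BallLE {P : Type} [Group P] (S T : Set P) : Prop :=
  ∃ C : ℕ, ∀ n, (wordBall S n).ncard ≤ (wordBall T (C * n)).ncard

theorem BallLE.trans {P : Type} [Group P] {S T U : Set P} (h : BallLE S T) (h' : BallLE T U) :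
    BallLE S U := by
  obtain ⟨C, hC⟩ := h
  obtain ⟨C', hC'⟩ := h'
  exact ⟨C' * C, fun n => (hC n).trans ((hC' _).trans_eq (by rw [mul_assoc]))⟩

theorem ballLE_of_subset_closure {P : Type} [Group P] {S T : Set P} (hS : S.Finite)
    (hT : T.Finite) (h : S ⊆ Subgroup.closure T) : BallLE S T := by
  obtain ⟨C, hC⟩ := exists_wordBall_subset hS h
  exact ⟨C, fun n => ncard_wordBall_le hT (hC n)⟩

theorem IsFiniteGeneratingSet.ballLE {P : Type} [Group P] {T : Set P} (hT : T.Finite)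
    {S : Set (Subgroup.closure T)} (hS : IsFiniteGeneratingSet S) :
    BallLE (Subtype.val '' S) T ∧ BallLE T (Subtype.val '' S) := by
  refine ⟨ballLE_of_subset_closure (hS.1.image _) hT ?_,
    ballLE_of_subset_closure hT (hS.1.image _) ?_⟩
  · rintro _ ⟨s, -, rfl⟩
    exact s.2
  · rw [closure_image_val hS.2]
    exact Subgroup.subset_closure

theorem growthFunction_natCast {P : Type} [Group P] {H : Subgroup P} (S : Set H) (n : ℕ) :
    growthFunction S n = ((wordBall (Subtype.val '' S) n).ncard : ℝ) := by
  rw [growthFunction_eq S n.cast_nonneg, Nat.floor_natCast]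

theorem ncard_wordBall_le_growthFunction {P : Type} [Group P] {H : Subgroup P} {S : Set H}
    (hS : S.Finite) {n : ℕ} {x : ℝ} (h : (n : ℝ) ≤ x) :
    ((wordBall (Subtype.val '' S) n).ncard : ℝ) ≤ growthFunction S x := by
  rw [growthFunction_eq S (n.cast_nonneg.trans h)]
  exact_mod_cast ncard_wordBall_mono (hS.image _) (Nat.le_floor h)

theorem growthEquiv_of_ballLE {P : Type} [Group P] {G H : Subgroup P} {S : Set G} {T : Set H}
    (hS : S.Finite) (hT : T.Finite)
    (h : BallLE (Subtype.val '' S) (Subtype.val '' T))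
    (h' : BallLE (Subtype.val '' T) (Subtype.val '' S)) :
    GrowthEquiv (growthFunction S) (growthFunction T) := by
  obtain ⟨C, hC⟩ := h
  obtain ⟨C', hC'⟩ := h'
  have hpos : (0 : ℝ) < C + C' + 1 := by positivity
  -- One constant serves both directions; the `1` keeps it positive if `C = C' = 0`.
  refine ⟨C + C' + 1, hpos, fun n => ⟨?_, ?_⟩⟩
  · have hn : (0 : ℝ) ≤ (n : ℝ) / (C + C' + 1) := by positivity
    rw [growthFunction_eq S hn]
    refine (Nat.cast_le.mpr (hC _)).trans (ncard_wordBall_le_growthFunction hT ?_)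
    have h1 := Nat.floor_le hn
    rw [le_div_iff₀ hpos] at h1
    push_cast
    have h2 : (0 : ℝ) ≤ ⌊(n : ℝ) / (C + C' + 1)⌋₊ := Nat.cast_nonneg _
    nlinarith [mul_nonneg h2 C'.cast_nonneg (α := ℝ)]
  · rw [growthFunction_natCast]
    refine (Nat.cast_le.mpr (hC' _)).trans (ncard_wordBall_le_growthFunction hS ?_)
    push_cast
    have : (0 : ℝ) ≤ n := n.cast_nonneg
    gcongr
    linarith [(C.cast_nonneg : (0 : ℝ) ≤ C)]

theorem growthLE_exp_rpow_of_ballLE {P : Type} [Group P] {H : Subgroup P} {S : Set H}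
    (hS : S.Finite) {T : Set P} (h : BallLE T (Subtype.val '' S)) {α : ℝ} {C : ℕ}
    (hT : ∀ n : ℕ, Real.exp ((n : ℝ) ^ α) ≤ ((wordBall T (C * n)).ncard : ℝ)) :
    GrowthLE (fun x => Real.exp (x ^ α)) (growthFunction S) := by
  obtain ⟨C', hC'⟩ := h
  refine ⟨C' * C + 1, by positivity, fun n => (hT n).trans ((Nat.cast_le.mpr (hC' _)).trans
    (ncard_wordBall_le_growthFunction hS ?_))⟩
  push_cast
  have : (0 : ℝ) ≤ n := n.cast_nonneg
  linarith

theorem growthLE_of_ballLE_exp_rpow {P : Type} [Group P] {H : Subgroup P} {S : Set H}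
    {T : Set P} (h : BallLE (Subtype.val '' S) T) {β : ℝ} (hβ : 0 < β) {C : ℝ} (hC : 0 < C)
    (hT : ∀ n : ℕ, ((wordBall T n).ncard : ℝ) ≤ Real.exp (C * (n : ℝ) ^ β)) :
    GrowthLE (growthFunction S) (fun x => Real.exp (x ^ β)) := by
  obtain ⟨C', hC'⟩ := h
  -- A factor `C` in the exponent becomes `C ^ β⁻¹` in the argument of `x ↦ exp (x ^ β)`.
  refine ⟨C ^ β⁻¹ * (C' + 1), by positivity, fun n => ?_⟩
  rw [growthFunction_natCast]
  refine (Nat.cast_le.mpr (hC' n)).trans ((hT _).trans (Real.exp_le_exp.mpr ?_))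
  rw [mul_assoc, Real.mul_rpow (by positivity) (by positivity), ← Real.rpow_mul hC.le,
    inv_mul_cancel₀ hβ.ne', Real.rpow_one]
  push_cast
  gcongr
  linarith

theorem isLittleO_pow_growthFunction {P : Type} [Group P] {H : Subgroup P} {S : Set H}
    (hS : S.Finite) {α : ℝ} (hα : 0 < α)
    (h : GrowthLE (fun x => Real.exp (x ^ α)) (growthFunction S)) (d : ℕ) :
    (fun n : ℕ => (n : ℝ) ^ d) =o[Filter.atTop] fun n : ℕ => growthFunction S n := by
  obtain ⟨C₀, hC₀, h₀⟩ := h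
  obtain ⟨C, hC⟩ := exists_nat_ge C₀
  have hC1 : 0 < C := by exact_mod_cast hC₀.trans_le hC
  have hCr : (0 : ℝ) < C := by exact_mod_cast hC1
  have hb : (0 : ℝ) < ((2 * C : ℝ)⁻¹) ^ α := by positivity
  have h1 := ((isLittleO_rpow_exp_pos_mul_atTop (d / α) hb).comp_tendsto
    (tendsto_rpow_atTop hα)).comp_tendsto tendsto_natCast_atTop_atTop
  refine Asymptotics.IsLittleO.trans_isBigO (g := fun n : ℕ =>
    Real.exp (((2 * C : ℝ)⁻¹) ^ α * (n : ℝ) ^ α)) ?_ ?_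
  · refine h1.congr_left fun n => ?_
    simp only [Function.comp_apply]
    rw [← Real.rpow_mul n.cast_nonneg, mul_div_cancel₀ _ hα.ne', Real.rpow_natCast]
  · refine Asymptotics.IsBigO.of_bound 1 ?_
    filter_upwards [Filter.eventually_ge_atTop C] with n hn
    -- The hypothesis bounds growth from below only at multiples of `C₀`, so it is applied at `n /
    -- C` (rounded down), which is at least `n / (2C)` once `n ≥ C`.
    have hm : 1 ≤ n / C := (Nat.one_le_div_iff hC1).mpr hn
    have h2 : n < C * (n / C + 1) := Nat.lt_mul_div_succ n hC1
    have h3 : (n : ℝ) ≤ 2 * C * (n / C : ℕ) := by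
      have : n ≤ 2 * C * (n / C) := by nlinarith
      exact_mod_cast this
    have h4 : C₀ * (n / C : ℕ) ≤ n := by
      have : C * (n / C) ≤ n := Nat.mul_div_le n C
      calc C₀ * (n / C : ℕ) ≤ C * (n / C : ℕ) := by gcongr
        _ ≤ n := by exact_mod_cast this
    have h5 : Real.exp (((2 * C : ℝ)⁻¹) ^ α * (n : ℝ) ^ α) ≤ growthFunction S n := by
      calc _ = Real.exp (((2 * C : ℝ)⁻¹ * n) ^ α) := by
            rw [Real.mul_rpow (by positivity) (by positivity)]
        _ ≤ Real.exp (((n / C : ℕ) : ℝ) ^ α) := by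
            apply Real.exp_le_exp.mpr
            apply Real.rpow_le_rpow (by positivity) _ hα.le
            rwa [inv_mul_le_iff₀ (by positivity)]
        _ ≤ growthFunction S (C₀ * (n / C : ℕ)) := h₀ _
        _ ≤ growthFunction S n := by
            rw [growthFunction_eq S (by positivity), growthFunction_natCast]
            exact_mod_cast ncard_wordBall_mono (hS.image _) (Nat.floor_le_of_le h4)
    rw [one_mul, Real.norm_of_nonneg (Real.exp_pos _).le]
    exact h5.trans (le_abs_self _)

theorem growthFunction_isLittleO_pow {P : Type} [Group P] {H : Subgroup P} {S : Set H}
    {β : ℝ} (hβ : β < 1)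
    (h : GrowthLE (growthFunction S) (fun x => Real.exp (x ^ β))) {c : ℝ} (hc : 1 < c) :
    (fun n : ℕ => growthFunction S n) =o[Filter.atTop] fun n : ℕ => c ^ n := by
  obtain ⟨C, hC, hle⟩ := h
  have hlog : 0 < Real.log c := Real.log_pos hc
  refine Asymptotics.IsBigO.trans_isLittleO (g := fun n : ℕ => Real.exp ((C * n) ^ β)) ?_ ?_
  · refine Asymptotics.IsBigO.of_bound 1 (Filter.Eventually.of_forall fun n => ?_)
    rw [one_mul, growthFunction_natCast, Real.norm_of_nonneg (Nat.cast_nonneg _),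
      Real.norm_of_nonneg (Real.exp_pos _).le, ← growthFunction_natCast]
    exact hle n
  · have hpow : (fun n : ℕ => c ^ n) = fun n : ℕ => Real.exp (n * Real.log c) := by
      funext n
      rw [Real.exp_nat_mul, Real.exp_log (by linarith)]
    rw [hpow, Real.isLittleO_exp_comp_exp_comp]
    have h1 : (fun n : ℕ => (C * (n : ℝ)) ^ β) =o[Filter.atTop] fun n : ℕ => (n : ℝ) := by
      have h0 : (fun x : ℝ => x ^ β) =o[Filter.atTop] fun x : ℝ => x := by
        refine Asymptotics.isLittleO_of_tendsto' ?_ ?_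
        · filter_upwards [Filter.eventually_gt_atTop (0 : ℝ)] with x hx hx0
          exact absurd hx0 hx.ne'
        · refine (tendsto_rpow_neg_atTop (sub_pos.mpr hβ)).congr' ?_
          filter_upwards [Filter.eventually_gt_atTop (0 : ℝ)] with x hx
          rw [neg_sub, Real.rpow_sub hx, Real.rpow_one]
      have := (h0.comp_tendsto tendsto_natCast_atTop_atTop).const_mul_left (C ^ β)
      refine this.congr (fun n => ?_) fun n => ?_
      · rw [Real.mul_rpow hC.le (by positivity)]
        rfl
      · simp
    have h2 := h1.def (show 0 < Real.log c / 2 by positivity)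
    refine Filter.tendsto_atTop_mono' _ ?_
      (tendsto_natCast_atTop_atTop.const_mul_atTop (show 0 < Real.log c / 2 by positivity))
    filter_upwards [h2] with n hn
    rw [Real.norm_eq_abs, Real.norm_of_nonneg n.cast_nonneg] at hn
    have := (le_abs_self _).trans hn
    linarith

/-! ### The contraction coefficient -/

/-- The defining polynomial increases on the positive reals and changes sign on `(0, 1)`. Dividing
its equation by `η < 1` shows that the sum with exponents lowered by one exceeds `2` at `η`; by
continuity it still does at some `y` slightly smaller than `η`. -/
theorem exists_contraction_root {r : ℕ} (hr : 4 ≤ r) :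
    ∃ η : ℝ, (0 < η ∧ η ^ r + η ^ (r - 1) + η ^ (r - 2) - 2 = 0) ∧
      (∀ x : ℝ, 0 < x → x ^ r + x ^ (r - 1) + x ^ (r - 2) - 2 = 0 → x = η) ∧ η < 1 ∧
      ∃ y : ℝ, 0 < y ∧ y < η ∧ 2 ≤ y ^ (r - 1) + y ^ (r - 1 - 1) + y ^ (r - 1 - 2) := by
  have hcont : Continuous fun x : ℝ => x ^ r + x ^ (r - 1) + x ^ (r - 2) - 2 := by fun_prop
  have hmono : ∀ x y : ℝ, 0 < x → x < y →
      x ^ r + x ^ (r - 1) + x ^ (r - 2) - 2 < y ^ r + y ^ (r - 1) + y ^ (r - 2) - 2 := by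
    intro x y hx hxy
    have h : ∀ n ≠ 0, x ^ n < y ^ n := fun n hn => pow_lt_pow_left₀ hxy hx.le hn
    linarith [h r (by omega), h (r - 1) (by omega), h (r - 2) (by omega)]
  obtain ⟨η, ⟨h0, h1⟩, hη⟩ := intermediate_value_Ioo (zero_le_one (α := ℝ)) hcont.continuousOn
    (show (0 : ℝ) ∈ _ by
      simp [show r ≠ 0 by omega, show r - 1 ≠ 0 by omega, show r - 2 ≠ 0 by omega]
      norm_num)
  simp only at hη
  refine ⟨η, ⟨h0, hη⟩, fun x hx hx0 => ?_, h1, ?_⟩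
  · rcases lt_trichotomy x η with h | h | h
    · linarith [hmono x η hx h]
    · exact h
    · linarith [hmono η x h0 h]
  · have hgt : 2 < η ^ (r - 1) + η ^ (r - 1 - 1) + η ^ (r - 1 - 2) := by
      have h2 : η * (η ^ (r - 1) + η ^ (r - 1 - 1) + η ^ (r - 1 - 2)) = 2 := by
        obtain ⟨s, rfl⟩ : ∃ s, r = s + 3 := ⟨r - 3, by omega⟩
        simp only [show s + 3 - 1 = s + 2 by omega, show s + 3 - 2 = s + 1 by omega,
          show s + 2 - 1 = s + 1 by omega, show s + 2 - 2 = s by omega] at hη ⊢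
        linear_combination hη
      nlinarith
    have hc : ContinuousAt (fun x : ℝ => x ^ (r - 1) + x ^ (r - 1 - 1) + x ^ (r - 1 - 2)) η := by
      fun_prop
    have hev : ∀ᶠ y in nhdsWithin η (Set.Iio η), (0 < y ∧ y < η) ∧
        2 < y ^ (r - 1) + y ^ (r - 1 - 1) + y ^ (r - 1 - 2) := by
      refine Filter.Eventually.and ?_ (nhdsWithin_le_nhds (hc.eventually (lt_mem_nhds hgt)))
      exact Ioo_mem_nhdsLT h0
    obtain ⟨y, ⟨hy0, hy1⟩, hy⟩ := hev.exists
    exact ⟨y, hy0, hy1, hy.le⟩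

/-! ### Growth of Sushchansky groups -/

theorem ballLE_gensH_gensG {p : ℕ} [Fact p.Prime] (lam : ZMod (p ^ 2) ≃ ZMod p × ZMod p) :
    BallLE (gensH lam) (gensG lam) :=
  ⟨5, ncard_wordBall_gensH_le lam⟩

theorem ballLE_gensG_gensH {p : ℕ} [Fact p.Prime] (hp : 2 < p)
    (lam : ZMod (p ^ 2) ≃ ZMod p × ZMod p) : BallLE (gensG lam) (gensH lam) := by
  obtain ⟨M, hM⟩ := ncard_wordBall_gensG_le lam
  obtain ⟨C, hC⟩ := exists_ncard_wordBall_gensH_pow_le hp lam M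
  refine ⟨C, fun n => ?_⟩
  -- At radius `0` the constant `M` cannot be absorbed, but both balls are singletons.
  rcases Nat.eq_zero_or_pos n with rfl | hn
  · simp [ncard_wordBall_zero]
  · exact (hM n).trans (hC n hn)

theorem exp_rpow_le_ncard_wordBall_gensH {p : ℕ} [Fact p.Prime] (hp : 2 < p)
    (lam : ZMod (p ^ 2) ≃ ZMod p × ZMod p) : ∃ C : ℕ, ∀ n : ℕ,
      Real.exp ((n : ℝ) ^ (Real.log p / (Real.log p + Real.log 2))) ≤
        ((wordBall (gensH lam) (C * n)).ncard : ℝ) := by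
  obtain ⟨C₁, h₁⟩ := exp_rpow_le_ncard_spinBall hp (coeff lam) (coeff_surjective lam)
  obtain ⟨C₂, h₂⟩ := exists_spinBall_subset_wordBall lam
  refine ⟨C₂ * (2 * C₁ + 1), fun n => ?_⟩
  rcases Nat.eq_zero_or_pos n with rfl | hn
  · have hlogp : 0 < Real.log p := Real.log_pos (by exact_mod_cast (by omega : 1 < p))
    have hlog2 : 0 < Real.log 2 := Real.log_pos (by norm_num)
    have hα : Real.log p / (Real.log p + Real.log 2) ≠ 0 := by positivity
    simp [ncard_wordBall_zero, Real.zero_rpow hα]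
  · refine (h₁ n 1).trans (Nat.cast_le.mpr ((Set.ncard_le_ncard (h₂ _)
      (finite_wordBall (finite_gensH lam) _)).trans
      (ncard_wordBall_mono (finite_gensH lam) ?_)))
    calc C₂ * (2 * (C₁ * n) + 1) ≤ C₂ * (2 * (C₁ * n) + n) :=
          Nat.mul_le_mul_left _ (Nat.add_le_add_left hn _)
      _ = _ := by ring

theorem ncard_wordBall_gensH_le_exp_rpow {p : ℕ} [Fact p.Prime] (hp : 2 < p)
    (lam : ZMod (p ^ 2) ≃ ZMod p × ZMod p) {y η : ℝ} (hy0 : 0 < y) (hyη : y < η) (hη : η < 1)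
    (hy : 2 ≤ y ^ (p ^ 2 - 1) + y ^ (p ^ 2 - 1 - 1) + y ^ (p ^ 2 - 1 - 2)) :
    ∃ C : ℝ, 0 < C ∧ ∀ n : ℕ, ((wordBall (gensH lam) n).ncard : ℝ) ≤
      Real.exp (C * (n : ℝ) ^ (Real.log p / (Real.log p - Real.log η))) := by
  have hN : 9 ≤ p ^ 2 := by nlinarith
  have hR := exists_coeff_eq_zero hp lam
  have hR2 : 3 ≤ p ^ 2 - 1 := by omega
  have hy1 : y < 1 := hyη.trans hη
  obtain ⟨C, hC, h⟩ := ncard_contractingBall_le_exp hR hR2 hy0 hy hyη hη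
  refine ⟨C, hC, fun n => le_trans ?_ (h n 1)⟩
  refine Nat.cast_le.mpr (Set.ncard_le_ncard (wordBall_gensH_subset lam ?_ n)
    (finite_contractingBall hR hR2 hy0 hy1 hy 1 n))
  rintro (d | a)
  · exact (spinWeight_le _ _ hy0 hy1 1 d).trans (pow_le_one₀ hy0.le hy1.le)
  · have : 0 < y ^ (p ^ 2 - 1) := by positivity
    simp only [Sum.elim_inr]
    linarith

theorem theorem16 (p : ℕ) [Fact p.Prime] (hp : 2 < p)
    (lam : ZMod (p ^ 2) ≃ ZMod p × ZMod p) :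
    HasIntermediateGrowth (sushchanskyGroup lam) ∧
    (∀ S : Set (sushchanskyGroup lam), IsFiniteGeneratingSet S →
      GrowthLE (fun x => Real.exp (x ^ (Real.log p / (Real.log p + Real.log 2))))
        (growthFunction S)) ∧
    (∃ η : ℝ,
      (0 < η ∧ η ^ (p ^ 2) + η ^ (p ^ 2 - 1) + η ^ (p ^ 2 - 2) - 2 = 0) ∧
      (∀ x : ℝ, 0 < x → x ^ (p ^ 2) + x ^ (p ^ 2 - 1) + x ^ (p ^ 2 - 2) - 2 = 0 → x = η) ∧
      ∀ S : Set (sushchanskyGroup lam), IsFiniteGeneratingSet S →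
        GrowthLE (growthFunction S)
          (fun x => Real.exp (x ^ (Real.log p / (Real.log p - Real.log η))))) ∧
    IsGGroup (groupH lam) ∧
    (∀ (S : Set (sushchanskyGroup lam)) (T : Set (groupH lam)),
      IsFiniteGeneratingSet S → IsFiniteGeneratingSet T →
      GrowthEquiv (growthFunction S) (growthFunction T)) := by
  have hN : 9 ≤ p ^ 2 := by nlinarith
  have hlogp : 0 < Real.log p := Real.log_pos (by exact_mod_cast (by omega : 1 < p))
  have hlog2 : 0 < Real.log 2 := Real.log_pos (by norm_num)
  obtain ⟨η, hη, huniq, hη1, y, hy0, hyη, hy⟩ := exists_contraction_root (r := p ^ 2) (by omega)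
  have hlogη : Real.log η < 0 := Real.log_neg hη.1 hη1
  have hβ0 : 0 < Real.log p / (Real.log p - Real.log η) := div_pos hlogp (by linarith)
  have hβ1 : Real.log p / (Real.log p - Real.log η) < 1 :=
    (div_lt_one (by linarith)).mpr (by linarith)
  obtain ⟨C₁, h₁⟩ := exp_rpow_le_ncard_wordBall_gensH hp lam
  obtain ⟨C₂, hC₂, h₂⟩ := ncard_wordBall_gensH_le_exp_rpow hp lam hy0 hyη hη1 hy
  have hGH := ballLE_gensG_gensH hp lam
  have hHG := ballLE_gensH_gensG lam
  have hlower : ∀ S : Set (sushchanskyGroup lam), IsFiniteGeneratingSet S →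
      GrowthLE (fun x => Real.exp (x ^ (Real.log p / (Real.log p + Real.log 2))))
        (growthFunction S) := fun S hS =>
    growthLE_exp_rpow_of_ballLE hS.1
      (hHG.trans (IsFiniteGeneratingSet.ballLE (finite_gensG lam) hS).2) h₁
  have hupper : ∀ S : Set (sushchanskyGroup lam), IsFiniteGeneratingSet S →
      GrowthLE (growthFunction S)
        (fun x => Real.exp (x ^ (Real.log p / (Real.log p - Real.log η)))) := fun S hS =>
    growthLE_of_ballLE_exp_rpow
      ((IsFiniteGeneratingSet.ballLE (finite_gensG lam) hS).1.trans hGH) hβ0 hC₂ h₂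
  refine ⟨⟨?_, fun S hS => ⟨?_, ?_⟩⟩, hlower, ⟨η, hη, huniq, hupper⟩, isGGroup_groupH lam, ?_⟩
  · exact (Group.fg_iff_subgroup_fg _).mpr
      ((Subgroup.fg_iff _).mpr ⟨gensG lam, rfl, finite_gensG lam⟩)
  · exact isLittleO_pow_growthFunction hS.1 (by positivity) (hlower S hS)
  · exact fun c hc => growthFunction_isLittleO_pow hβ1 (hupper S hS) hc
  · intro S T hS hT
    obtain ⟨hS1, hS2⟩ := IsFiniteGeneratingSet.ballLE (finite_gensG lam) hS
    obtain ⟨hT1, hT2⟩ := IsFiniteGeneratingSet.ballLE (finite_gensH lam) hT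
    exact growthEquiv_of_ballLE hS.1 hT.1 (hS1.trans (hGH.trans hT2)) (hT1.trans (hHG.trans hS2))
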